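/- Let $(\mathfrak g,\mathfrak g^*)$ be a finite-dimensional real Lie bialgebra, and let $\mathfrak d=\mathfrak g\oplus\mathfrak g^*$ be its double: the unique Lie algebra in which $\mathfrak g$ and $\mathfrak g^*$ are Lie subalgebras and the form $\langle (X_1,f_1),(X_2,f_2)\rangle=f_1(X_2)+f_2(X_1)$ is $\operatorname{ad}$-invariant. Let $r=P_{\mathfrak g}-P_{\mathfrak g^*}$ be the difference of the projections onto the two summands. Let $D$ be a connected Lie group with Lie algebra $\mathfrak d$, and let $G,G^*\subset D$ be the connected Lie subgroups with Lie algebras $\mathfrak g,\mathfrak g^*$. For $\varphi\in C^\infty(D)$ let $X_\varphi,X'_\varphi:D\to\mathfrak d$ be the gradients defined by $$\langle X_\varphi(x),\xi\rangle=\tfrac{d}{dt}\Big|_{t=0}\varphi(e^{t\xi}x),\qquad \langle X'_\varphi(x),\xi\rangle=\tfrac{d}{dt}\Big|_{t=0}\varphi(xe^{t\xi}),\qquad \xi\in\mathfrak d,$$ and equip $D$ with the Poisson bracket $$\{\varphi,\psi\}_+=\tfrac12\langle rX_\varphi,X_\psi\rangle+\tfrac12\langle rX'_\varphi,X'_\psi\rangle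 .$$ Then: (i) The actions of $G$ and of $G^*$ on $D$ by left translations and by right translations (four actions) are admissible: for each of them the invariant functions in $C^\infty(D)$ form a subalgebra closed under $\{\cdot,\cdot\}_+$. (ii) If $G$ is closed in $D$, the actions of $G$ on $D$ by left and by right translations form a dual pair: the algebra of left $G$-invariant functions and the algebra of right $G$-invariant functions are the centralizers of each other in $C^\infty(D)$ with respect to $\{\cdot,\cdot\}_+$. Likewise, if $G^*$ is closed in $D$, the actions of $G^*$ on $D$ by left and by right translations form a dual pair. -/

import Mathlib

open scoped Manifold ContDiff

noncomputable section

/-- A Lie bialgebra `(𝔤, 𝔤*)` over `ℝ`: a Lie bracket on the dual space of the Lie algebra `𝔤`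
whose transpose `δ : 𝔤 → 𝔤 ⊗ 𝔤`, `δ(X)(f, g) = [f, g]_*(X)`, is a 1-cocycle for the adjoint
action, i.e. `δ([X, Y]) = X · δ(Y) - Y · δ(X)`. -/
structure LieBialgebra (𝔤 : Type*) [LieRing 𝔤] [LieAlgebra ℝ 𝔤] where
  /-- the Lie bracket `[f, g]_*` on `𝔤*` -/
  dualBracket : Module.Dual ℝ 𝔤 →ₗ[ℝ] Module.Dual ℝ 𝔤 →ₗ[ℝ] Module.Dual ℝ 𝔤
  dualBracket_self : ∀ f, dualBracket f f = 0
  dualBracket_jacobi : ∀ f g h,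
    dualBracket f (dualBracket g h) + dualBracket g (dualBracket h f)
      + dualBracket h (dualBracket f g) = 0
  cocycle : ∀ (X Y : 𝔤) (f g : Module.Dual ℝ 𝔤),
    dualBracket f g ⁅X, Y⁆ =
      (dualBracket (f ∘ₗ (LieAlgebra.ad ℝ 𝔤 X : 𝔤 →ₗ[ℝ] 𝔤)) g Y
        + dualBracket f (g ∘ₗ (LieAlgebra.ad ℝ 𝔤 X : 𝔤 →ₗ[ℝ] 𝔤)) Y)
      - (dualBracket (f ∘ₗ (LieAlgebra.ad ℝ 𝔤 Y : 𝔤 →ₗ[ℝ] 𝔤)) g X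
        + dualBracket f (g ∘ₗ (LieAlgebra.ad ℝ 𝔤 Y : 𝔤 →ₗ[ℝ] 𝔤)) X)

namespace PoissonDouble

section Algebra

variable (𝔤 : Type*) [AddCommGroup 𝔤] [Module ℝ 𝔤]

/-- The canonical bilinear form `⟨(X₁, f₁), (X₂, f₂)⟩ = f₁(X₂) + f₂(X₁)` on `𝔤 ⊕ 𝔤*`. -/
def form : LinearMap.BilinForm ℝ (𝔤 × Module.Dual ℝ 𝔤) :=
  LinearMap.mk₂ ℝ (fun a b => a.2 b.1 + b.2 a.1)
    (fun a b c => by simp; ring) (fun r a b => by simp; ring)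
    (fun a b c => by simp; ring) (fun r a b => by simp; ring)

variable {𝔤} in
@[simp] theorem form_apply (a b : 𝔤 × Module.Dual ℝ 𝔤) :
    form 𝔤 a b = a.2 b.1 + b.2 a.1 := rfl

theorem form_nondegenerate [FiniteDimensional ℝ 𝔤] : (form 𝔤).Nondegenerate := by
  have h : ∀ a : 𝔤 × Module.Dual ℝ 𝔤, (∀ b, form 𝔤 a b = 0) → a = 0 := by
    rintro ⟨X, f⟩ h
    refine Prod.ext ?_ ?_
    · refine (Module.forall_dual_apply_eq_zero_iff ℝ X).1 fun g => ?_
      simpa using h (0, g)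
    · refine LinearMap.ext fun Y => ?_
      simpa using h (Y, 0)
  refine ⟨h, fun b hb => h b fun a => ?_⟩
  have := hb a
  simp only [form_apply] at this ⊢
  linarith

/-- The operator `r = P_𝔤 - P_𝔤*` on `𝔤 ⊕ 𝔤*`. -/
def rMatrix : (𝔤 × Module.Dual ℝ 𝔤) →ₗ[ℝ] (𝔤 × Module.Dual ℝ 𝔤) :=
  LinearMap.inl ℝ _ _ ∘ₗ LinearMap.fst ℝ _ _ - LinearMap.inr ℝ _ _ ∘ₗ LinearMap.snd ℝ _ _

variable {𝔤} in
@[simp] theorem rMatrix_apply (a : 𝔤 × Module.Dual ℝ 𝔤) : rMatrix 𝔤 a = (a.1, -a.2) := by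
  ext <;> simp [rMatrix]

/-- The vector of `𝔤 ⊕ 𝔤*` representing a linear functional through the canonical form. -/
def represent [FiniteDimensional ℝ 𝔤] (ℓ : Module.Dual ℝ (𝔤 × Module.Dual ℝ 𝔤)) :
    𝔤 × Module.Dual ℝ 𝔤 :=
  ((form 𝔤).toDual (form_nondegenerate 𝔤)).symm ℓ

variable {𝔤} in
theorem form_represent [FiniteDimensional ℝ 𝔤] (ℓ : Module.Dual ℝ (𝔤 × Module.Dual ℝ 𝔤))
    (a : 𝔤 × Module.Dual ℝ 𝔤) : form 𝔤 (represent 𝔤 ℓ) a = ℓ a :=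
  LinearMap.BilinForm.apply_toDual_symm_apply (hB := form_nondegenerate 𝔤) ℓ a

/-- Coordinate expression of `⟨r a, b⟩` for the vectors `a`, `b` representing `ℓ`, `m`. -/
theorem form_rMatrix_represent [FiniteDimensional ℝ 𝔤]
    (ℓ m : Module.Dual ℝ (𝔤 × Module.Dual ℝ 𝔤)) :
    form 𝔤 (rMatrix 𝔤 (represent 𝔤 ℓ)) (represent 𝔤 m) =
      ∑ i, (m (Module.finBasis ℝ 𝔤 i, 0) * ℓ (0, (Module.finBasis ℝ 𝔤).coord i)
        - ℓ (Module.finBasis ℝ 𝔤 i, 0) * m (0, (Module.finBasis ℝ 𝔤).coord i)) := by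
  have key : ∀ (f : Module.Dual ℝ 𝔤) (X : 𝔤),
      f X = ∑ i, f (Module.finBasis ℝ 𝔤 i) * (Module.finBasis ℝ 𝔤).coord i X := by
    intro f X
    conv_lhs => rw [← (Module.finBasis ℝ 𝔤).sum_repr X]
    rw [map_sum]
    exact Finset.sum_congr rfl fun i _ => by
      rw [map_smul, smul_eq_mul, mul_comm, Module.Basis.coord_apply]
  have h1 : ∀ (p : Module.Dual ℝ (𝔤 × Module.Dual ℝ 𝔤)) (Y : 𝔤),
      (represent 𝔤 p).2 Y = p (Y, 0) := fun p Y => by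
    rw [← form_represent p (Y, 0)]; simp
  have h2 : ∀ (p : Module.Dual ℝ (𝔤 × Module.Dual ℝ 𝔤)) (g : Module.Dual ℝ 𝔤),
      g (represent 𝔤 p).1 = p (0, g) := fun p g => by
    rw [← form_represent p (0, g)]; simp
  rw [form_apply, rMatrix_apply]
  simp only [LinearMap.neg_apply]
  rw [key (represent 𝔤 ℓ).2, key (represent 𝔤 m).2, Finset.sum_sub_distrib]
  simp only [h1, h2]
  ring

end Algebra

section Group

variable {E : Type*} [NormedAddCommGroup E] [NormedSpace ℝ E]
  {D : Type*} [TopologicalSpace D] [ChartedSpace E D] [Group D]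

/-- The identification `e : 𝔤 ⊕ 𝔤* ≃ Lie(D)` makes the Lie algebra of `D` the double of the Lie
bialgebra `(𝔤, 𝔤*)`: it carries to `𝔤 ⊕ 𝔤*` the (unique) Lie algebra structure for which `𝔤` and
`𝔤*` are Lie subalgebras and the canonical form is `ad`-invariant. -/
structure IsDouble {𝔤 : Type*} [LieRing 𝔤] [LieAlgebra ℝ 𝔤] (β : LieBialgebra 𝔤)
    (e : (𝔤 × Module.Dual ℝ 𝔤) ≃ₗ[ℝ] GroupLieAlgebra 𝓘(ℝ, E) D) : Prop where
  bracket_left : ∀ X Y : 𝔤, ⁅e (X, 0), e (Y, 0)⁆ = e (⁅X, Y⁆, 0)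
  bracket_right : ∀ f g : Module.Dual ℝ 𝔤, ⁅e (0, f), e (0, g)⁆ = e (0, β.dualBracket f g)
  invariant : ∀ a b c : 𝔤 × Module.Dual ℝ 𝔤,
    form 𝔤 (e.symm ⁅e a, e b⁆) c + form 𝔤 b (e.symm ⁅e a, e c⁆) = 0

/-- `ι : G → D` exhibits the Lie group `G` as a Lie subgroup (not necessarily closed) of `D` with
Lie algebra `𝔨 ⊆ Lie(D)`: an injective smooth homomorphism whose differential at the identity is
injective with image `𝔨`. -/
structure IsLieSubgroup {V : Type*} [NormedAddCommGroup V] [NormedSpace ℝ V]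
    {G : Type*} [TopologicalSpace G] [ChartedSpace V G] [Group G] (ι : G →* D)
    (𝔨 : Submodule ℝ (GroupLieAlgebra 𝓘(ℝ, E) D)) : Prop where
  contMDiff : ContMDiff 𝓘(ℝ, V) 𝓘(ℝ, E) ∞ ι
  injective : Function.Injective ι
  injective_mfderiv : Function.Injective (mfderiv 𝓘(ℝ, V) 𝓘(ℝ, E) ι 1)
  range_mfderiv : ∀ v : E, v ∈ Set.range (mfderiv 𝓘(ℝ, V) 𝓘(ℝ, E) ι 1) ↔ v ∈ 𝔨

/-- The linear functional `ξ ↦ d/dt|₀ φ(exp(tξ) x)` on `Lie(D)`. -/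
def leftDifferential (φ : D → ℝ) (x : D) : GroupLieAlgebra 𝓘(ℝ, E) D →ₗ[ℝ] ℝ :=
  (mfderiv 𝓘(ℝ, E) 𝓘(ℝ, ℝ) (fun g => φ (g * x)) (1 : D)).toLinearMap

/-- The linear functional `ξ ↦ d/dt|₀ φ(x exp(tξ))` on `Lie(D)`. -/
def rightDifferential (φ : D → ℝ) (x : D) : GroupLieAlgebra 𝓘(ℝ, E) D →ₗ[ℝ] ℝ :=
  (mfderiv 𝓘(ℝ, E) 𝓘(ℝ, ℝ) (fun g => φ (x * g)) (1 : D)).toLinearMap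

theorem contMDiff_mfderiv_param [LieGroup 𝓘(ℝ, E) ∞ D] (F : D → D → ℝ)
    (hF : ContMDiff (𝓘(ℝ, E).prod 𝓘(ℝ, E)) 𝓘(ℝ, ℝ) ∞ (Function.uncurry F))
    (ξ : GroupLieAlgebra 𝓘(ℝ, E) D) :
    ContMDiff 𝓘(ℝ, E) 𝓘(ℝ, ℝ) ∞
      (fun x => (mfderiv 𝓘(ℝ, E) 𝓘(ℝ, ℝ) (F x) (1 : D) ξ : ℝ)) := by
  intro x₀
  have h := ContMDiffAt.mfderiv_apply (I := 𝓘(ℝ, E)) (I' := 𝓘(ℝ, ℝ)) (J := 𝓘(ℝ, E))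
    (J' := 𝓘(ℝ, E)) (x₀ := x₀) (m := ∞) (n := ∞) F (fun _ => (1 : D)) id (fun _ => (ξ : E))
    hF.contMDiffAt contMDiffAt_const contMDiffAt_id contMDiffAt_const le_rfl
  refine h.congr_of_eventuallyEq (Filter.Eventually.of_forall fun x => ?_)
  have h1 := (tangentBundleCore 𝓘(ℝ, E) D).coordChange_self (achart E (1 : D)) 1
    (mem_chart_source E (1 : D)) ξ
  have h2 := (tangentBundleCore 𝓘(ℝ, ℝ) ℝ).coordChange_self (achart ℝ (F x 1)) (F x 1)
    (mem_chart_source ℝ (F x 1)) (mfderiv 𝓘(ℝ, E) 𝓘(ℝ, ℝ) (F x) (1 : D) ξ)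
  have key := inTangentCoordinates_eq (I := 𝓘(ℝ, E)) (I' := 𝓘(ℝ, ℝ)) (fun _ : D => (1 : D))
    (fun x => F x 1) (fun x => mfderiv 𝓘(ℝ, E) 𝓘(ℝ, ℝ) (F x) (1 : D)) (x₀ := x₀) (x := x)
    (mem_chart_source E (1 : D)) (mem_chart_source ℝ (F x 1))
  have key2 := congrArg (fun L : E →L[ℝ] ℝ => L ξ) key
  refine Eq.trans ?_ key2.symm
  refine h2.symm.trans ?_
  exact congrArg (fun v : E => ((tangentBundleCore 𝓘(ℝ, ℝ) ℝ).coordChange (achart ℝ (F x 1))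
    (achart ℝ (F x 1)) (F x 1)) ((mfderiv 𝓘(ℝ, E) 𝓘(ℝ, ℝ) (F x) (1 : D)) v)) h1.symm

variable {𝔤 : Type*} [LieRing 𝔤] [LieAlgebra ℝ 𝔤] [FiniteDimensional ℝ 𝔤]
  (e : (𝔤 × Module.Dual ℝ 𝔤) ≃ₗ[ℝ] GroupLieAlgebra 𝓘(ℝ, E) D)

/-- The left gradient `X_φ(x)`: `⟨X_φ(x), ξ⟩ = d/dt|₀ φ(exp(tξ) x)`. -/
def leftGradient (φ : D → ℝ) (x : D) : 𝔤 × Module.Dual ℝ 𝔤 :=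
  represent 𝔤 (leftDifferential φ x ∘ₗ e.toLinearMap)

/-- The right gradient `X'_φ(x)`: `⟨X'_φ(x), ξ⟩ = d/dt|₀ φ(x exp(tξ))`. -/
def rightGradient (φ : D → ℝ) (x : D) : 𝔤 × Module.Dual ℝ 𝔤 :=
  represent 𝔤 (rightDifferential φ x ∘ₗ e.toLinearMap)

/-- The function `{φ, ψ}₊ = ½ ⟨r X_φ, X_ψ⟩ + ½ ⟨r X'_φ, X'_ψ⟩`. -/
def bracketFun (φ ψ : D → ℝ) (x : D) : ℝ :=
  1 / 2 * form 𝔤 (rMatrix 𝔤 (leftGradient e φ x)) (leftGradient e ψ x)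
    + 1 / 2 * form 𝔤 (rMatrix 𝔤 (rightGradient e φ x)) (rightGradient e ψ x)

theorem contMDiff_leftDifferential [LieGroup 𝓘(ℝ, E) ∞ D] (φ : C^∞⟮𝓘(ℝ, E), D; ℝ⟯)
    (ξ : GroupLieAlgebra 𝓘(ℝ, E) D) :
    ContMDiff 𝓘(ℝ, E) 𝓘(ℝ, ℝ) ∞ (fun x => leftDifferential φ x ξ) :=
  contMDiff_mfderiv_param (fun x g => φ (g * x))
    (φ.contMDiff.comp (contMDiff_snd.mul contMDiff_fst)) ξ

theorem contMDiff_rightDifferential [LieGroup 𝓘(ℝ, E) ∞ D] (φ : C^∞⟮𝓘(ℝ, E), D; ℝ⟯)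
    (ξ : GroupLieAlgebra 𝓘(ℝ, E) D) :
    ContMDiff 𝓘(ℝ, E) 𝓘(ℝ, ℝ) ∞ (fun x => rightDifferential φ x ξ) :=
  contMDiff_mfderiv_param (fun x g => φ (x * g))
    (φ.contMDiff.comp (contMDiff_fst.mul contMDiff_snd)) ξ

theorem contMDiff_bracketFun [LieGroup 𝓘(ℝ, E) ∞ D] (φ ψ : C^∞⟮𝓘(ℝ, E), D; ℝ⟯) :
    ContMDiff 𝓘(ℝ, E) 𝓘(ℝ, ℝ) ∞ (bracketFun e φ ψ) := by
  have key : ∀ d : C^∞⟮𝓘(ℝ, E), D; ℝ⟯ → D → GroupLieAlgebra 𝓘(ℝ, E) D →ₗ[ℝ] ℝ,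
      (∀ χ ξ, ContMDiff 𝓘(ℝ, E) 𝓘(ℝ, ℝ) ∞ (fun x => d χ x ξ)) →
      ContMDiff 𝓘(ℝ, E) 𝓘(ℝ, ℝ) ∞ (fun x => 1 / 2 * form 𝔤
        (rMatrix 𝔤 (represent 𝔤 (d φ x ∘ₗ e.toLinearMap)))
        (represent 𝔤 (d ψ x ∘ₗ e.toLinearMap))) := by
    intro d hd
    simp only [form_rMatrix_represent, LinearMap.comp_apply]
    exact contMDiff_const.mul (contMDiff_finsetSum fun i _ =>
      ((hd ψ _).mul (hd φ _)).sub ((hd φ _).mul (hd ψ _)))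
  exact (key (fun χ x => leftDifferential χ x) contMDiff_leftDifferential).add
    (key (fun χ x => rightDifferential χ x) contMDiff_rightDifferential)

/-- The bracket `{φ, ψ}₊ = ½ ⟨r X_φ, X_ψ⟩ + ½ ⟨r X'_φ, X'_ψ⟩` on `C^∞(D)`. -/
def plusBracket [LieGroup 𝓘(ℝ, E) ∞ D] (φ ψ : C^∞⟮𝓘(ℝ, E), D; ℝ⟯) : C^∞⟮𝓘(ℝ, E), D; ℝ⟯ :=
  ⟨bracketFun e φ ψ, contMDiff_bracketFun e φ ψ⟩

/-- `G` acting on `D` by left translations through `ι : G → D`. -/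
def leftTranslation {G : Type*} [Group G] (ι : G →* D) (g : G) (x : D) : D := ι g * x

/-- `G` acting on `D` by right translations through `ι : G → D`. -/
def rightTranslation {G : Type*} [Group G] (ι : G →* D) (g : G) (x : D) : D := x * ι g

end Group

section Actions

variable {E : Type*} [NormedAddCommGroup E] [NormedSpace ℝ E]
  {M : Type*} [TopologicalSpace M] [ChartedSpace E M]

/-- The algebra of smooth functions invariant under a family of transformations of `M`. -/
def invariants {H : Type*} (act : H → M → M) : Subalgebra ℝ C^∞⟮𝓘(ℝ, E), M; ℝ⟯ where
  carrier := {φ | ∀ h x, φ (act h x) = φ x}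
  mul_mem' := fun {a b} ha hb h x => by
    simp only [ContMDiffMap.coe_mul, Pi.mul_apply]
    rw [ha, hb]
  add_mem' := fun {a b} ha hb h x => by
    simp only [ContMDiffMap.coe_add, Pi.add_apply]
    rw [ha, hb]
  algebraMap_mem' := fun r h x => rfl

variable (br : C^∞⟮𝓘(ℝ, E), M; ℝ⟯ → C^∞⟮𝓘(ℝ, E), M; ℝ⟯ → C^∞⟮𝓘(ℝ, E), M; ℝ⟯)

/-- An action is admissible for the bracket `br` if the subalgebra of invariant functions is
closed under `br`. -/
def IsAdmissible {H : Type*} (act : H → M → M) : Prop :=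
  ∀ φ ∈ invariants (E := E) act, ∀ ψ ∈ invariants (E := E) act,
    br φ ψ ∈ invariants (E := E) act

/-- The centralizer of a set of functions with respect to the bracket `br`. -/
def poissonCentralizer (S : Set C^∞⟮𝓘(ℝ, E), M; ℝ⟯) : Set C^∞⟮𝓘(ℝ, E), M; ℝ⟯ :=
  {ψ | ∀ φ ∈ S, br φ ψ = 0}

/-- Two admissible actions form a dual pair if their algebras of invariants are the centralizers of
each other. -/
structure IsDualPair {H H' : Type*} (act : H → M → M) (act' : H' → M → M) : Prop where
  admissible_left : IsAdmissible br act
  admissible_right : IsAdmissible br act'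
  left_eq : (invariants (E := E) act : Set C^∞⟮𝓘(ℝ, E), M; ℝ⟯) =
    poissonCentralizer br (invariants (E := E) act')
  right_eq : (invariants (E := E) act' : Set C^∞⟮𝓘(ℝ, E), M; ℝ⟯) =
    poissonCentralizer br (invariants (E := E) act)

end Actions

end PoissonDouble

end

/-!
# Dual pairs of translation actions on the double of a Lie bialgebra

The operator `r` is the identity on `𝔤` and minus the identity on `𝔤*`, so both subalgebras are
eigenspaces of `r` for an eigenvalue `σ = ±1`, and each is its own orthogonal for the canonical
form. Everything is proved for a subgroup `ι : G → D` whose Lie algebra `𝔨` is such an eigenspace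
(`HasEigenLieAlgebra`).

*Admissibility.* The left gradient of a left `G`-invariant function annihilates `𝔨`, hence lies in
`𝔨` (`leftGradient_eigen`). So the left term of the bracket of two such functions vanishes, and the
right term is left-invariant because the right gradients are. The inversion of `D` preserves the
bracket and exchanges the left and the right actions (`plusBracket_compInv`), which gives the
statement for right translations.

*Commutation.* The gradients are related by `X_φ(x) = Ad_x X'_φ(x)`, since the `ad`-invariance of
the form on the connected group `D` integrates to `Ad`-invariance (`Ad_invariant`). For a right
`G`-invariant `φ` the bracket is therefore
`{φ, ψ}₊ = ½ ⟨(r + σ) X_φ, X_ψ⟩ = σ ⟨P Ad_x X'_φ(x), X_ψ(x)⟩`, where `P` is the projection onto `𝔨`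
and `X'_φ(x) ∈ 𝔨`. It vanishes if `ψ` is left-invariant, because then `X_ψ ∈ 𝔨`.

*Maximality.* If `ψ` commutes with all right-invariant functions, the formula shows that `X_ψ(x)` is
orthogonal to every `P Ad_x X'_φ(x)`. Two facts are needed to get `X_ψ(x) ∈ 𝔨`.

* As `G` is closed, there is a smooth local slice for its right action, and a function cut off on
  the slice extends to a right-invariant function; so `X'_φ(x)` can be any vector of `𝔨`
  (`exists_slice`, `exists_invariant_function`).
* The endomorphism `P ∘ Ad_x` of `𝔨` is onto for a dense set of `x` (`dense_proj_Ad_surjOn`). It is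
  the identity at `x = 1`, and its determinant is analytic along the integral curves of
  left-invariant fields, where `Ad` is an exponential (`Ad_curve_eq_exp`). Products of these curves
  fill a neighbourhood of the identity, so the interior of the zero set of the determinant is open
  and closed, hence empty.

By continuity `X_ψ(x) ∈ 𝔨` for all `x`, and `ψ` is left-invariant as `G` is connected. The
other equality of a dual pair follows by inversion.
-/

noncomputable section

namespace PoissonDouble

/-! ### Derivatives in model spaces -/

section Charts

variable {E : Type*} [NormedAddCommGroup E] [NormedSpace ℝ E]
  {M : Type*} [TopologicalSpace M] [ChartedSpace E M]
  {F : Type*} [NormedAddCommGroup F] [NormedSpace ℝ F]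
  {N : Type*} [TopologicalSpace N] [ChartedSpace F N]
  {F' : Type*} [NormedAddCommGroup F'] [NormedSpace ℝ F']
  {N' : Type*} [TopologicalSpace N'] [ChartedSpace F' N']

/-- `HasMFDerivAt` with the derivative regarded as a map between the model spaces, to which all
tangent spaces are definitionally equal. -/
def HasModelDerivAt (f : M → N) (x : M) (L : E →L[ℝ] F) : Prop :=
  HasMFDerivAt 𝓘(ℝ, E) 𝓘(ℝ, F) f x L

/-- `mfderiv` regarded as a map between the model spaces. -/
def modelDeriv (f : M → N) (x : M) : E →L[ℝ] F := mfderiv 𝓘(ℝ, E) 𝓘(ℝ, F) f x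

theorem hasModelDerivAt_modelDeriv {f : M → N} {x : M}
    (hf : MDifferentiableAt 𝓘(ℝ, E) 𝓘(ℝ, F) f x) :
    HasModelDerivAt f x (modelDeriv f x : E →L[ℝ] F) := hf.hasMFDerivAt

theorem HasModelDerivAt.modelDeriv_eq {f : M → N} {x : M} {L : E →L[ℝ] F}
    (h : HasModelDerivAt f x L) : modelDeriv f x = L := HasMFDerivAt.mfderiv h

theorem HasModelDerivAt.mdifferentiableAt {f : M → N} {x : M} {L : E →L[ℝ] F}
    (h : HasModelDerivAt f x L) : MDifferentiableAt 𝓘(ℝ, E) 𝓘(ℝ, F) f x :=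
  HasMFDerivAt.mdifferentiableAt h

theorem HasModelDerivAt.unique {f : M → N} {x : M} {L L' : E →L[ℝ] F}
    (h : HasModelDerivAt f x L) (h' : HasModelDerivAt f x L') : L = L' :=
  hasMFDerivAt_unique h h'

theorem HasModelDerivAt.comp {g : N → N'} {f : M → N} {x : M} {y : N} {L : E →L[ℝ] F}
    {L' : F →L[ℝ] F'} (hg : HasModelDerivAt g y L') (hf : HasModelDerivAt f x L) (hy : f x = y) :
    HasModelDerivAt (fun z => g (f z)) x (L' ∘L L) := by
  subst hy
  exact HasMFDerivAt.comp x hg hf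

theorem hasModelDerivAt_iff_hasFDerivAt {f : E → F} {x : E} {L : E →L[ℝ] F} :
    HasModelDerivAt f x L ↔ HasFDerivAt f L x := hasMFDerivAt_iff_hasFDerivAt

theorem hasModelDerivAt_const (c : N) (x : M) :
    HasModelDerivAt (fun _ : M => c) x (0 : E →L[ℝ] F) := hasMFDerivAt_const c x

theorem hasModelDerivAt_id (x : M) :
    HasModelDerivAt (fun y : M => y) x (ContinuousLinearMap.id ℝ E) := hasMFDerivAt_id x

theorem HasModelDerivAt.congr_of_eventuallyEq {f g : M → N} {x : M} {L : E →L[ℝ] F}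
    (h : HasModelDerivAt f x L) (hfg : g =ᶠ[nhds x] f) : HasModelDerivAt g x L :=
  HasMFDerivAt.congr_of_eventuallyEq h hfg

variable [IsManifold 𝓘(ℝ, E) ∞ M]

theorem contMDiffAt_extChartAt_symm {x : M} {u : E} (hu : u ∈ (extChartAt 𝓘(ℝ, E) x).target) :
    ContMDiffAt 𝓘(ℝ, E) 𝓘(ℝ, E) ∞ (extChartAt 𝓘(ℝ, E) x).symm u :=
  (contMDiffOn_extChartAt_symm x).contMDiffAt ((isOpen_extChartAt_target x).mem_nhds hu)

theorem hasModelDerivAt_extChartAt_self (x : M) :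
    HasModelDerivAt (extChartAt 𝓘(ℝ, E) x) x (ContinuousLinearMap.id ℝ E) := by
  have : IsManifold 𝓘(ℝ, E) 1 M := IsManifold.of_le (n := ∞) (by simp)
  have h := hasModelDerivAt_modelDeriv (mdifferentiableAt_extChartAt (I := 𝓘(ℝ, E))
    (mem_chart_source E x))
  have h' : modelDeriv (extChartAt 𝓘(ℝ, E) x) x = ContinuousLinearMap.id ℝ E :=
    mfderiv_extChartAt_self (I := 𝓘(ℝ, E)) (x := x)
  rwa [h'] at h

theorem hasModelDerivAt_extChartAt_symm_self (x : M) :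
    HasModelDerivAt (extChartAt 𝓘(ℝ, E) x).symm (extChartAt 𝓘(ℝ, E) x x)
      (ContinuousLinearMap.id ℝ E) := by
  have h := hasModelDerivAt_modelDeriv ((contMDiffAt_extChartAt_symm
    (mem_extChartAt_target (I := 𝓘(ℝ, E)) x)).mdifferentiableAt (by simp))
  have h1 := (hasModelDerivAt_extChartAt_self x).comp h (extChartAt_to_inv x)
  have h2 := h1.unique ((hasModelDerivAt_id (extChartAt 𝓘(ℝ, E) x x)).congr_of_eventuallyEq (by
    filter_upwards [extChartAt_target_mem_nhds (I := 𝓘(ℝ, E)) x] with u hu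
    exact (extChartAt 𝓘(ℝ, E) x).right_inv hu))
  rw [ContinuousLinearMap.id_comp] at h2
  rwa [h2] at h

/-- A differentiable function on a connected manifold with vanishing derivative is constant. -/
theorem eq_of_modelDeriv_eq_zero [ConnectedSpace M] {f : M → ℝ}
    (h : ∀ x, HasModelDerivAt f x (0 : E →L[ℝ] ℝ)) (x y : M) : f x = f y := by
  have key : IsLocallyConstant f := by
    rw [IsLocallyConstant.iff_eventually_eq]
    intro x
    set c := extChartAt 𝓘(ℝ, E) x
    obtain ⟨ε, hε, hball⟩ := Metric.isOpen_iff.1 (isOpen_extChartAt_target (I := 𝓘(ℝ, E)) x)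
      (c x) (mem_extChartAt_target x)
    have h1 : ∀ u ∈ Metric.ball (c x) ε,
        HasFDerivAt (fun u => f (c.symm u)) (0 : E →L[ℝ] ℝ) u := by
      intro u hu
      have h2 := hasModelDerivAt_modelDeriv
        ((contMDiffAt_extChartAt_symm (hball hu)).mdifferentiableAt (by simp))
      have h3 := (h (c.symm u)).comp h2 rfl
      rw [ContinuousLinearMap.zero_comp] at h3
      exact hasModelDerivAt_iff_hasFDerivAt.1 h3
    have h4 : ∀ u ∈ Metric.ball (c x) ε, f (c.symm u) = f x := by
      intro u hu
      have := (convex_ball (c x) ε).is_const_of_fderivWithin_eq_zero (𝕜 := ℝ)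
        (f := fun u => f (c.symm u))
        (fun v hv => (h1 v hv).differentiableAt.differentiableWithinAt)
        (fun v hv => by
          rw [fderivWithin_of_isOpen Metric.isOpen_ball hv]; exact (h1 v hv).fderiv)
        hu (Metric.mem_ball_self hε)
      simpa [c] using this
    filter_upwards [extChartAt_source_mem_nhds (I := 𝓘(ℝ, E)) x,
      (continuousAt_extChartAt (I := 𝓘(ℝ, E)) x).preimage_mem_nhds (Metric.ball_mem_nhds _ hε)]
      with y hy1 hy2
    have := h4 (c y) hy2
    rwa [c.left_inv hy1] at this
  exact key.apply_eq_of_isPreconnected isPreconnected_univ trivial trivial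

end Charts

section LieGroup

variable {E : Type*} [NormedAddCommGroup E] [NormedSpace ℝ E]
  {K : Type*} [TopologicalSpace K] [ChartedSpace E K] [Group K] [LieGroup 𝓘(ℝ, E) ∞ K]
  {F : Type*} [NormedAddCommGroup F] [NormedSpace ℝ F]

theorem hasModelDerivAt_mul_left (x y : K) :
    HasModelDerivAt (fun g : K => x * g) y (modelDeriv (fun g : K => x * g) y : E →L[ℝ] E) :=
  hasModelDerivAt_modelDeriv ((contMDiff_mul_left (n := ∞)).mdifferentiable (by simp) _)

theorem hasModelDerivAt_mul_right (x y : K) :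
    HasModelDerivAt (fun g : K => g * x) y (modelDeriv (fun g : K => g * x) y : E →L[ℝ] E) :=
  hasModelDerivAt_modelDeriv ((contMDiff_mul_right (n := ∞)).mdifferentiable (by simp) _)

/-- A function on a connected Lie group all of whose right translates have vanishing derivative at
the identity is constant. -/
theorem eq_of_modelDeriv_translate_eq_zero [ConnectedSpace K] {f : K → ℝ}
    (h : ∀ x, HasModelDerivAt (fun g => f (g * x)) (1 : K) (0 : E →L[ℝ] ℝ)) (x y : K) :
    f x = f y := by
  refine eq_of_modelDeriv_eq_zero (E := E) (fun x => ?_) x y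
  have h4 := (h x).comp (hasModelDerivAt_mul_right x⁻¹ x) (mul_inv_cancel x)
  simpa using h4

end LieGroup

/-! ### The adjoint representation and its differential -/

theorem one_add_one_le_infty : (1 : WithTop ℕ∞) + 1 ≤ ∞ := by
  rw [one_add_one_eq_two]
  exact WithTop.coe_le_coe.2 le_top

section Adjoint

variable {E : Type*} [NormedAddCommGroup E] [NormedSpace ℝ E]
  {D : Type*} [TopologicalSpace D] [ChartedSpace E D] [Group D]

/-- The adjoint representation: the derivative at the identity of the conjugation by `x`. -/
def Ad (x : D) : E →L[ℝ] E := modelDeriv (fun g : D => x * g * x⁻¹) 1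

/-- The chart of `D` at the identity. -/
local notation "chart₁" => extChartAt 𝓘(ℝ, E) (1 : D)

theorem contMDiffAt_chart_one {x : D} (hx : x = 1) : ContMDiffAt 𝓘(ℝ, E) 𝓘(ℝ, E) ∞ chart₁ x := by
  subst hx
  exact contMDiffAt_extChartAt

variable [LieGroup 𝓘(ℝ, E) ∞ D]

theorem hasModelDerivAt_conj (x : D) :
    HasModelDerivAt (fun g : D => x * g * x⁻¹) 1 (Ad x : E →L[ℝ] E) :=
  hasModelDerivAt_modelDeriv (((contMDiff_mul_right (n := ∞)).comp
    (contMDiff_mul_left (n := ∞))).mdifferentiable (by simp) _)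

@[simp] theorem Ad_one : (Ad (1 : D) : E →L[ℝ] E) = ContinuousLinearMap.id ℝ E :=
  (hasModelDerivAt_conj (1 : D)).unique (by simpa using hasModelDerivAt_id (E := E) (1 : D))

theorem Ad_mul (x y : D) : (Ad (x * y) : E →L[ℝ] E) = Ad x ∘L Ad y := by
  refine (hasModelDerivAt_conj (x * y)).unique ?_
  have h := (hasModelDerivAt_conj (E := E) x).comp (hasModelDerivAt_conj (E := E) y) (by simp)
  simpa [mul_assoc] using h

theorem Ad_apply_Ad_inv (x : D) (v : E) : (Ad x : E →L[ℝ] E) ((Ad x⁻¹ : E →L[ℝ] E) v) = v := by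
  have := congrArg (fun L : E →L[ℝ] E => L v) (Ad_mul (E := E) x x⁻¹)
  simpa using this.symm

/-- The multiplication of the group in the chart at the identity. -/
def chartMul (E D : Type*) [NormedAddCommGroup E] [NormedSpace ℝ E]
    [TopologicalSpace D] [ChartedSpace E D] [Group D] (p : E × E) : E :=
  extChartAt 𝓘(ℝ, E) (1 : D)
    ((extChartAt 𝓘(ℝ, E) (1 : D)).symm p.1 * (extChartAt 𝓘(ℝ, E) (1 : D)).symm p.2)

/-- The conjugation of the group in the chart at the identity. -/
def chartConj (E D : Type*) [NormedAddCommGroup E] [NormedSpace ℝ E]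
    [TopologicalSpace D] [ChartedSpace E D] [Group D] (p : E × E) : E :=
  extChartAt 𝓘(ℝ, E) (1 : D)
    ((extChartAt 𝓘(ℝ, E) (1 : D)).symm p.1 * (extChartAt 𝓘(ℝ, E) (1 : D)).symm p.2
      * ((extChartAt 𝓘(ℝ, E) (1 : D)).symm p.1)⁻¹)

theorem contMDiffAt_chart_symm_fst :
    ContMDiffAt 𝓘(ℝ, E × E) 𝓘(ℝ, E) ∞ (fun p : E × E => (chart₁).symm p.1) (chart₁ 1, chart₁ 1) :=
  (contMDiffAt_extChartAt_symm (mem_extChartAt_target (1 : D))).comp (chart₁ 1, chart₁ 1)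
    contDiffAt_fst.contMDiffAt

theorem contMDiffAt_chart_symm_snd :
    ContMDiffAt 𝓘(ℝ, E × E) 𝓘(ℝ, E) ∞ (fun p : E × E => (chart₁).symm p.2) (chart₁ 1, chart₁ 1) :=
  (contMDiffAt_extChartAt_symm (mem_extChartAt_target (1 : D))).comp (chart₁ 1, chart₁ 1)
    contDiffAt_snd.contMDiffAt

theorem contDiffAt_chartMul : ContDiffAt ℝ ∞ (chartMul E D) (chart₁ 1, chart₁ 1) := by
  rw [← contMDiffAt_iff_contDiffAt]
  exact (contMDiffAt_chart_one (by simp)).comp _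
    ((contMDiffAt_chart_symm_fst (D := D)).mul contMDiffAt_chart_symm_snd)

theorem contDiffAt_chartConj : ContDiffAt ℝ ∞ (chartConj E D) (chart₁ 1, chart₁ 1) := by
  rw [← contMDiffAt_iff_contDiffAt]
  exact (contMDiffAt_chart_one (by simp)).comp _
    (((contMDiffAt_chart_symm_fst (D := D)).mul contMDiffAt_chart_symm_snd).mul
      (contMDiffAt_chart_symm_fst (D := D)).inv)

/-- For `u` near the identity, `Ad u` is the partial derivative of the conjugation. -/
theorem Ad_chart_symm :
    ∀ᶠ u in nhds (chart₁ 1), ∀ η : E, (Ad ((chart₁).symm u) : E →L[ℝ] E) η =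
      fderiv ℝ (chartConj E D) (u, chart₁ 1) (0, η) := by
  have h1 : ∀ᶠ p in nhds (chart₁ 1, chart₁ 1), DifferentiableAt ℝ (chartConj E D) p :=
    (((contDiffAt_chartConj (E := E) (D := D)).of_le (m := 1) (by simp)).eventually
      (by simp)).mono fun p hp => hp.differentiableAt (by simp)
  have h2 : Filter.Tendsto (fun u : E => (u, chart₁ 1)) (nhds (chart₁ 1))
      (nhds (chart₁ 1, chart₁ 1)) :=
    (Continuous.prodMk continuous_id continuous_const).tendsto (chart₁ 1)
  filter_upwards [h2.eventually h1] with u hu η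
  have h3 := (hasModelDerivAt_extChartAt_self (1 : D)).comp
    ((hasModelDerivAt_conj (E := E) ((chart₁).symm u)).comp (hasModelDerivAt_extChartAt_symm_self 1)
      (by simp)) (by simp)
  have h4 := hasModelDerivAt_iff_hasFDerivAt.1 h3
  have h5 : HasFDerivAt (fun v : E => (u, v)) (ContinuousLinearMap.inr ℝ E E) (chart₁ 1) :=
    hasFDerivAt_prodMk_right u (chart₁ 1)
  have h6 := (hu.hasFDerivAt.comp (chart₁ 1) h5).unique h4
  have h7 := congrArg (fun L : E →L[ℝ] E => L η) h6
  simpa using h7.symm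

/-- The left-invariant vector fields in the chart at the identity. -/
theorem mulInvariantVectorField_chart :
    ∀ᶠ u in nhds (chart₁ 1), ∀ η : E,
      (modelDeriv chart₁ ((chart₁).symm u) : E →L[ℝ] E)
        (modelDeriv (fun g : D => (chart₁).symm u * g) 1 η) =
      fderiv ℝ (chartMul E D) (u, chart₁ 1) (0, η) := by
  have h1 : ∀ᶠ p in nhds (chart₁ 1, chart₁ 1), DifferentiableAt ℝ (chartMul E D) p :=
    (((contDiffAt_chartMul (E := E) (D := D)).of_le (m := 1) (by simp)).eventually
      (by simp)).mono fun p hp => hp.differentiableAt (by simp)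
  have h2 : Filter.Tendsto (fun u : E => (u, chart₁ 1)) (nhds (chart₁ 1))
      (nhds (chart₁ 1, chart₁ 1)) :=
    (Continuous.prodMk continuous_id continuous_const).tendsto (chart₁ 1)
  filter_upwards [h2.eventually h1, extChartAt_target_mem_nhds (I := 𝓘(ℝ, E)) (1 : D)]
    with u hu hu' η
  have : IsManifold 𝓘(ℝ, E) 1 D := IsManifold.of_le (n := ∞) (by simp)
  have h0 : HasModelDerivAt chart₁ ((chart₁).symm u)
      (modelDeriv chart₁ ((chart₁).symm u) : E →L[ℝ] E) :=
    hasModelDerivAt_modelDeriv (mdifferentiableAt_extChartAt (by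
      rw [← extChartAt_source 𝓘(ℝ, E)]; exact (chart₁).map_target hu'))
  have h3 := h0.comp
    ((hasModelDerivAt_mul_left (E := E) ((chart₁).symm u) 1).comp
      (hasModelDerivAt_extChartAt_symm_self 1) (by simp)) (by simp)
  have h4 := hasModelDerivAt_iff_hasFDerivAt.1 h3
  have h5 : HasFDerivAt (fun v : E => (u, v)) (ContinuousLinearMap.inr ℝ E E) (chart₁ 1) :=
    hasFDerivAt_prodMk_right u (chart₁ 1)
  have h6 := (hu.hasFDerivAt.comp (chart₁ 1) h5).unique h4
  have h7 := congrArg (fun L : E →L[ℝ] E => L η) h6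
  simpa using h7.symm

theorem fderiv_chartMul_inl (η : E) : fderiv ℝ (chartMul E D) (chart₁ 1, chart₁ 1) (η, 0) = η := by
  have h0 := ((contDiffAt_chartMul (E := E) (D := D)).differentiableAt (by simp)).hasFDerivAt
  have h1 : HasFDerivAt (fun v : E => (v, chart₁ 1)) (ContinuousLinearMap.inl ℝ E E) (chart₁ 1) :=
    hasFDerivAt_prodMk_left (chart₁ 1) (chart₁ 1)
  have h2 := HasFDerivAt.comp (f := fun v : E => (v, chart₁ 1)) (chart₁ 1) h0 h1
  have h3 : HasFDerivAt (fun v : E => v) (ContinuousLinearMap.id ℝ E) (chart₁ 1) :=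
    hasFDerivAt_id _
  have h4 := h2.unique (h3.congr_of_eventuallyEq (by
    filter_upwards [extChartAt_target_mem_nhds (I := 𝓘(ℝ, E)) (1 : D)] with v hv
    simpa [chartMul] using (chart₁).right_inv hv))
  simpa using congrArg (fun L : E →L[ℝ] E => L η) h4

theorem fderiv_chartMul_inr (η : E) : fderiv ℝ (chartMul E D) (chart₁ 1, chart₁ 1) (0, η) = η := by
  have h0 := ((contDiffAt_chartMul (E := E) (D := D)).differentiableAt (by simp)).hasFDerivAt
  have h1 : HasFDerivAt (fun v : E => (chart₁ 1, v)) (ContinuousLinearMap.inr ℝ E E) (chart₁ 1) :=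
    hasFDerivAt_prodMk_right (chart₁ 1) (chart₁ 1)
  have h2 := h0.comp (chart₁ 1) h1
  have h3 : HasFDerivAt (fun v : E => v) (ContinuousLinearMap.id ℝ E) (chart₁ 1) :=
    hasFDerivAt_id _
  have h4 := h2.unique (h3.congr_of_eventuallyEq (by
    filter_upwards [extChartAt_target_mem_nhds (I := 𝓘(ℝ, E)) (1 : D)] with v hv
    simpa [chartMul] using (chart₁).right_inv hv))
  simpa using congrArg (fun L : E →L[ℝ] E => L η) h4

/-- The identity `(x y x⁻¹) x = x y` in the chart. -/
theorem chartMul_chartConj :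
    ∀ᶠ p in nhds (chart₁ 1, chart₁ 1),
      chartMul E D (chartConj E D p, p.1) = chartMul E D p := by
  have h : ContinuousAt (fun p : E × E => (chart₁).symm p.1 * (chart₁).symm p.2
      * ((chart₁).symm p.1)⁻¹) (chart₁ 1, chart₁ 1) :=
    (((contMDiffAt_chart_symm_fst (D := D)).mul contMDiffAt_chart_symm_snd).mul
      (contMDiffAt_chart_symm_fst (D := D)).inv).continuousAt
  filter_upwards [h.preimage_mem_nhds (extChartAt_source_mem_nhds' (I := 𝓘(ℝ, E)) (x := (1 : D))
    (by simp))]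
    with p hp
  simp only [chartMul, chartConj]
  rw [(chart₁).left_inv hp]
  simp

/-- The left-invariant field of `η` at `x` is the right-invariant field of `Ad x η`, in the
chart. -/
theorem fderiv_chartMul_eq_Ad :
    ∀ᶠ u in nhds (chart₁ 1), ∀ η : E, fderiv ℝ (chartMul E D) (u, chart₁ 1) (0, η) =
      fderiv ℝ (chartMul E D) (chart₁ 1, u) ((Ad ((chart₁).symm u) : E →L[ℝ] E) η, 0) := by
  have ht : Filter.Tendsto (fun u : E => (u, chart₁ 1)) (nhds (chart₁ 1))
      (nhds (chart₁ 1, chart₁ 1)) :=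
    (Continuous.prodMk continuous_id continuous_const).tendsto (chart₁ 1)
  have ht' : Filter.Tendsto (fun u : E => (chart₁ 1, u)) (nhds (chart₁ 1))
      (nhds (chart₁ 1, chart₁ 1)) :=
    (Continuous.prodMk continuous_const continuous_id).tendsto (chart₁ 1)
  have hC : ∀ᶠ p in nhds (chart₁ 1, chart₁ 1), DifferentiableAt ℝ (chartConj E D) p :=
    (((contDiffAt_chartConj (E := E) (D := D)).of_le (m := 1) (by simp)).eventually
      (by simp)).mono fun p hp => hp.differentiableAt (by simp)
  have hM : ∀ᶠ p in nhds (chart₁ 1, chart₁ 1), DifferentiableAt ℝ (chartMul E D) p :=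
    (((contDiffAt_chartMul (E := E) (D := D)).of_le (m := 1) (by simp)).eventually
      (by simp)).mono fun p hp => hp.differentiableAt (by simp)
  filter_upwards [ht.eventually (chartMul_chartConj (E := E) (D := D)).eventually_nhds,
    ht.eventually hC, ht'.eventually hM, Ad_chart_symm (E := E) (D := D)] with u h1 h2 h3 h4 η
  have h5 : chartConj E D (u, chart₁ 1) = chart₁ 1 := by simp [chartConj]
  have h6 : HasFDerivAt (fun p : E × E => (chartConj E D p, p.1))
      ((fderiv ℝ (chartConj E D) (u, chart₁ 1)).prod (ContinuousLinearMap.fst ℝ E E))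
      (u, chart₁ 1) := h2.hasFDerivAt.prodMk hasFDerivAt_fst
  have h7 : HasFDerivAt (chartMul E D) (fderiv ℝ (chartMul E D) (chart₁ 1, u))
      (chartConj E D (u, chart₁ 1), u) := by rw [h5]; exact h3.hasFDerivAt
  have h8 := (h7.comp (u, chart₁ 1) h6).congr_of_eventuallyEq
    (h1.mono fun _ hp => hp.symm)
  rw [h8.fderiv, h4]
  simp

/-- The derivative of the adjoint representation, in the chart at the identity. -/
theorem hasFDerivAt_Ad_chart : HasFDerivAt (fun u : E => (Ad ((chart₁).symm u) : E →L[ℝ] E))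
    (((ContinuousLinearMap.compL ℝ E (E × E) E).flip (ContinuousLinearMap.inr ℝ E E)) ∘L
      ((fderiv ℝ (fderiv ℝ (chartConj E D)) (chart₁ 1, chart₁ 1)) ∘L
        ContinuousLinearMap.inl ℝ E E)) (chart₁ 1) := by
  have h1 : HasFDerivAt (fun v : E => (v, chart₁ 1)) (ContinuousLinearMap.inl ℝ E E) (chart₁ 1) :=
    hasFDerivAt_prodMk_left (chart₁ 1) (chart₁ 1)
  have h2 : DifferentiableAt ℝ (fderiv ℝ (chartConj E D)) (chart₁ 1, chart₁ 1) :=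
    ((contDiffAt_chartConj (E := E) (D := D)).fderiv_right (m := 1)
      one_add_one_le_infty).differentiableAt
      (by simp)
  have h3 := (ContinuousLinearMap.hasFDerivAt ((ContinuousLinearMap.compL ℝ E (E × E) E).flip
    (ContinuousLinearMap.inr ℝ E E))).comp (chart₁ 1)
    (HasFDerivAt.comp (f := fun v : E => (v, chart₁ 1)) (chart₁ 1) h2.hasFDerivAt h1)
  refine h3.congr_of_eventuallyEq ?_
  filter_upwards [Ad_chart_symm (E := E) (D := D)] with u hu
  ext η
  simpa using hu η

theorem hasFDerivAt_fderiv_chartMul_left (w : E × E) :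
    HasFDerivAt (fun u => fderiv ℝ (chartMul E D) (u, chart₁ 1) w)
      (((ContinuousLinearMap.apply ℝ E w) ∘L
        (fderiv ℝ (fderiv ℝ (chartMul E D)) (chart₁ 1, chart₁ 1))) ∘L
          ContinuousLinearMap.inl ℝ E E) (chart₁ 1) := by
  have h1 : HasFDerivAt (fun v : E => (v, chart₁ 1)) (ContinuousLinearMap.inl ℝ E E) (chart₁ 1) :=
    hasFDerivAt_prodMk_left (chart₁ 1) (chart₁ 1)
  have h2 : DifferentiableAt ℝ (fderiv ℝ (chartMul E D)) (chart₁ 1, chart₁ 1) :=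
    ((contDiffAt_chartMul (E := E) (D := D)).fderiv_right (m := 1)
      one_add_one_le_infty).differentiableAt
      (by simp)
  exact HasFDerivAt.comp (f := fun v : E => (v, chart₁ 1)) (chart₁ 1)
    ((ContinuousLinearMap.apply ℝ E w).hasFDerivAt.comp (chart₁ 1, chart₁ 1) h2.hasFDerivAt) h1

/-- Antisymmetrization of the second derivative of the multiplication: the second derivative of
the conjugation is obtained by differentiating `fderiv_chartMul_eq_Ad` at the identity. -/
theorem snd_fderiv_chartConj (ξ η : E) :
    fderiv ℝ (fderiv ℝ (chartConj E D)) (chart₁ 1, chart₁ 1) (ξ, 0) (0, η) =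
      fderiv ℝ (fderiv ℝ (chartMul E D)) (chart₁ 1, chart₁ 1) (ξ, 0) (0, η)
      - fderiv ℝ (fderiv ℝ (chartMul E D)) (chart₁ 1, chart₁ 1) (η, 0) (0, ξ) := by
  have h1 : HasFDerivAt (fun v : E => (chart₁ 1, v)) (ContinuousLinearMap.inr ℝ E E) (chart₁ 1) :=
    hasFDerivAt_prodMk_right (chart₁ 1) (chart₁ 1)
  have h2 : DifferentiableAt ℝ (fderiv ℝ (chartMul E D)) (chart₁ 1, chart₁ 1) :=
    ((contDiffAt_chartMul (E := E) (D := D)).fderiv_right (m := 1)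
      one_add_one_le_infty).differentiableAt
      (by simp)
  have h3 := (hasFDerivAt_Ad_chart (E := E) (D := D)).clm_apply
    (hasFDerivAt_const η (chart₁ (1 : D)))
  have h4 := (h2.hasFDerivAt.comp (chart₁ 1) h1).clm_apply (h3.prodMk
    (hasFDerivAt_const (0 : E) (chart₁ (1 : D))))
  have h5 := (hasFDerivAt_fderiv_chartMul_left (E := E) (D := D) (0, η)).unique
    (h4.congr_of_eventuallyEq (by
      filter_upwards [fderiv_chartMul_eq_Ad (E := E) (D := D)] with u hu
      exact hu η))
  have h6 := congrArg (fun L : E →L[ℝ] E => L ξ) h5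
  have hs : IsSymmSndFDerivAt ℝ (chartMul E D) (chart₁ 1, chart₁ 1) :=
    (contDiffAt_chartMul (E := E) (D := D)).isSymmSndFDerivAt
      (by simpa only [minSmoothness_of_isRCLikeNormedField, one_add_one_eq_two]
        using one_add_one_le_infty)
  have h7 : (chart₁).symm (chart₁ 1) = (1 : D) := extChartAt_to_inv 1
  have h8 := fderiv_chartMul_inl (E := E) (D := D)
  generalize chart₁ (1 : D) = o at *
  rw [h7, Ad_one] at h6
  simp [h8] at h6
  rw [h6, hs (0, ξ) (η, 0)]
  abel

/-- The bracket of the Lie algebra as a Lie bracket of vector fields in the chart. -/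
theorem bracket_eq_lieBracket_chart (ξ η : GroupLieAlgebra 𝓘(ℝ, E) D) :
    ⁅ξ, η⁆ = VectorField.lieBracket ℝ
      (fun u : E => fderiv ℝ (chartMul E D) (u, chart₁ 1) (0, (ξ : E)))
      (fun u : E => fderiv ℝ (chartMul E D) (u, chart₁ 1) (0, (η : E))) (chart₁ 1) := by
  have : IsManifold 𝓘(ℝ, E) 1 D := IsManifold.of_le (n := ∞) (by simp)
  have hV : ∀ ζ : GroupLieAlgebra 𝓘(ℝ, E) D,
      (VectorField.mpullbackWithin 𝓘(ℝ, E) 𝓘(ℝ, E) (chart₁).symm (mulInvariantVectorField ζ)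
        (Set.range 𝓘(ℝ, E)) : E → E) =ᶠ[nhds (chart₁ 1)]
      fun u => fderiv ℝ (chartMul E D) (u, chart₁ 1) (0, (ζ : E)) := by
    intro ζ
    filter_upwards [mulInvariantVectorField_chart (E := E) (D := D),
      extChartAt_target_mem_nhds (I := 𝓘(ℝ, E)) (1 : D)] with u hu hu'
    rw [← hu ζ]
    have h := ContinuousLinearMap.inverse_eq
      (mfderivWithin_extChartAt_symm_comp_mfderiv_extChartAt (I := 𝓘(ℝ, E)) hu')
      (mfderiv_extChartAt_comp_mfderivWithin_extChartAt_symm (I := 𝓘(ℝ, E)) hu')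
    exact congrArg (fun L : TangentSpace 𝓘(ℝ, E) ((chart₁).symm u) →L[ℝ] E =>
      L (mulInvariantVectorField ζ ((chart₁).symm u))) h
  let V : GroupLieAlgebra 𝓘(ℝ, E) D → E → E := fun ζ =>
    VectorField.mpullbackWithin 𝓘(ℝ, E) 𝓘(ℝ, E) (chart₁).symm (mulInvariantVectorField ζ)
      (Set.range 𝓘(ℝ, E))
  have h1 : ⁅ξ, η⁆ = (modelDeriv (chart₁) (1 : D) : E →L[ℝ] E).inverse
    (VectorField.lieBracketWithin ℝ (V ξ) (V η)
      ((chart₁).symm ⁻¹' Set.univ ∩ Set.range 𝓘(ℝ, E)) (chart₁ 1)) := rfl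
  have h2 : ((chart₁).symm ⁻¹' Set.univ ∩ Set.range 𝓘(ℝ, E)) = Set.univ := by simp
  rw [h2, (hasModelDerivAt_extChartAt_self (1 : D)).modelDeriv_eq, ContinuousLinearMap.inverse_id,
    VectorField.lieBracketWithin_univ] at h1
  exact h1.trans ((hV ξ).lieBracket_vectorField_eq (hV η))

/-- The differential at the identity of the adjoint representation is `ad`. -/
theorem fderiv_Ad_chart_apply (ξ η : GroupLieAlgebra 𝓘(ℝ, E) D) :
    fderiv ℝ (fun u : E => (Ad ((chart₁).symm u) : E →L[ℝ] E)) (chart₁ 1) (ξ : E) (η : E)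
      = ⁅ξ, η⁆ := by
  have key : ∀ v w : E,
      fderiv ℝ (fun u : E => (Ad ((chart₁).symm u) : E →L[ℝ] E)) (chart₁ 1) v w =
      VectorField.lieBracket ℝ (fun u : E => fderiv ℝ (chartMul E D) (u, chart₁ 1) (0, v))
        (fun u : E => fderiv ℝ (chartMul E D) (u, chart₁ 1) (0, w)) (chart₁ 1) := by
    intro v w
    rw [(hasFDerivAt_Ad_chart (E := E) (D := D)).fderiv,
      VectorField.lieBracket, (hasFDerivAt_fderiv_chartMul_left (E := E) (D := D) _).fderiv,
      (hasFDerivAt_fderiv_chartMul_left (E := E) (D := D) _).fderiv,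
      fderiv_chartMul_inr, fderiv_chartMul_inr]
    exact snd_fderiv_chartConj (E := E) (D := D) v w
  exact (key ξ η).trans (bracket_eq_lieBracket_chart ξ η).symm

end Adjoint

/-! ### The adjoint representation along integral curves -/

section AdjointFlow

variable {E : Type*} [NormedAddCommGroup E] [NormedSpace ℝ E]
  {D : Type*} [TopologicalSpace D] [ChartedSpace E D] [Group D]

/-- The derivative at the identity of the adjoint representation; it is the bracket of the Lie
algebra, as a bounded bilinear map (`adMap_apply`). -/
def adMap (E D : Type*) [NormedAddCommGroup E] [NormedSpace ℝ E]
    [TopologicalSpace D] [ChartedSpace E D] [Group D] : E →L[ℝ] E →L[ℝ] E :=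
  fderiv ℝ (fun u : E => (Ad ((extChartAt 𝓘(ℝ, E) (1 : D)).symm u) : E →L[ℝ] E))
    (extChartAt 𝓘(ℝ, E) (1 : D) 1)

variable [LieGroup 𝓘(ℝ, E) ∞ D]

theorem adMap_apply (ξ η : GroupLieAlgebra 𝓘(ℝ, E) D) :
    adMap E D (ξ : E) (η : E) = ⁅ξ, η⁆ := fderiv_Ad_chart_apply ξ η

theorem hasModelDerivAt_Ad : HasModelDerivAt (fun x : D => (Ad x : E →L[ℝ] E)) 1 (adMap E D) := by
  have h1 : HasFDerivAt (fun u : E => (Ad ((extChartAt 𝓘(ℝ, E) (1 : D)).symm u) : E →L[ℝ] E))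
      (adMap E D) (extChartAt 𝓘(ℝ, E) (1 : D) 1) :=
    (hasFDerivAt_Ad_chart (E := E) (D := D)).differentiableAt.hasFDerivAt
  have h2 := (hasModelDerivAt_iff_hasFDerivAt.2 h1).comp
    (hasModelDerivAt_extChartAt_self (1 : D)) rfl
  rw [ContinuousLinearMap.comp_id] at h2
  refine h2.congr_of_eventuallyEq ?_
  filter_upwards [extChartAt_source_mem_nhds (I := 𝓘(ℝ, E)) (1 : D)] with x hx
  rw [(extChartAt 𝓘(ℝ, E) (1 : D)).left_inv hx]

/-- A bilinear form for which `ad` is skew is invariant under the adjoint representation of a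
connected group. -/
theorem Ad_invariant [ConnectedSpace D] (B : E →L[ℝ] E →L[ℝ] ℝ)
    (hB : ∀ ξ η ζ : E, B (adMap E D ξ η) ζ + B η (adMap E D ξ ζ) = 0) (x : D) (η ζ : E) :
    B ((Ad x : E →L[ℝ] E) η) ((Ad x : E →L[ℝ] E) ζ) = B η ζ := by
  have key : ∀ y : D, HasModelDerivAt (fun g : D => B ((Ad (g * y) : E →L[ℝ] E) η)
      ((Ad (g * y) : E →L[ℝ] E) ζ)) (1 : D) (0 : E →L[ℝ] ℝ) := by
    intro y
    set v := (Ad y : E →L[ℝ] E) η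
    set w := (Ad y : E →L[ℝ] E) ζ
    have hq : HasFDerivAt (fun T : E →L[ℝ] E => B (T v) (T w)) _
        (ContinuousLinearMap.id ℝ E) :=
      (B.hasFDerivAt.comp (ContinuousLinearMap.id ℝ E)
        (ContinuousLinearMap.apply ℝ E v).hasFDerivAt).clm_apply
        (ContinuousLinearMap.apply ℝ E w).hasFDerivAt
    have h := (hasModelDerivAt_iff_hasFDerivAt.2 hq).comp (hasModelDerivAt_Ad (E := E) (D := D))
      Ad_one
    convert h using 1
    · ext g
      simp [Ad_mul, v, w]
    · ext ξ
      have := hB ξ v w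
      simp
      linarith
  have h := eq_of_modelDeriv_translate_eq_zero (E := E)
    (f := fun g : D => B ((Ad g : E →L[ℝ] E) η) ((Ad g : E →L[ℝ] E) ζ)) key x 1
  simpa using h

/-- A left-invariant vector field has a local integral curve through the identity. -/
theorem exists_integralCurve [CompleteSpace E] (ξ : E) :
    ∃ γ : ℝ → D, γ 0 = 1 ∧ ∀ᶠ t in nhds (0 : ℝ), HasModelDerivAt γ t
      ((1 : ℝ →L[ℝ] ℝ).smulRight ((modelDeriv (fun g : D => γ t * g) 1 : E →L[ℝ] E) ξ)) := by
  have : LieGroup 𝓘(ℝ, E) (minSmoothness ℝ 3) D := LieGroup.of_le (n := ∞) (by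
    simp only [minSmoothness_of_isRCLikeNormedField]
    exact WithTop.coe_le_coe.2 le_top)
  have hv := (contMDiffAt_mulInvariantVectorField (I := 𝓘(ℝ, E)) (G := D) (ξ : E)
    (g := 1)).of_le (m := 1) (by
      simp only [minSmoothness_of_isRCLikeNormedField]; exact one_le_two)
  have : IsManifold 𝓘(ℝ, E) 1 D := IsManifold.of_le (n := ∞) (by simp)
  obtain ⟨γ, h0, h1⟩ := exists_isMIntegralCurveAt_of_contMDiffAt_boundaryless 0 hv
  exact ⟨γ, h0, h1⟩

theorem hasModelDerivAt_inv_mul_curve {γ : ℝ → D} {ξ : E} {t : ℝ}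
    (h : HasModelDerivAt γ t
      ((1 : ℝ →L[ℝ] ℝ).smulRight ((modelDeriv (fun g : D => γ t * g) 1 : E →L[ℝ] E) ξ))) :
    HasModelDerivAt (fun s => (γ t)⁻¹ * γ s) t ((1 : ℝ →L[ℝ] ℝ).smulRight ξ) := by
  have h1 := (hasModelDerivAt_mul_left (E := E) (γ t)⁻¹ (γ t)).comp h rfl
  have h2 := (hasModelDerivAt_mul_left (E := E) (γ t)⁻¹ (γ t)).comp
    (hasModelDerivAt_mul_left (E := E) (γ t) 1) (mul_one _)
  have h3 := h2.unique (by simpa using hasModelDerivAt_id (E := E) (1 : D))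
  convert h1 using 1
  ext
  simpa using (congrArg (fun L : E →L[ℝ] E => L ξ) h3).symm

/-- Along an integral curve of a left-invariant vector field, `Ad` solves `T' = T ∘ ad ξ`. -/
theorem hasDerivAt_Ad_curve {γ : ℝ → D} {ξ : E} {t : ℝ}
    (h : HasModelDerivAt γ t
      ((1 : ℝ →L[ℝ] ℝ).smulRight ((modelDeriv (fun g : D => γ t * g) 1 : E →L[ℝ] E) ξ))) :
    HasDerivAt (fun s => (Ad (γ s) : E →L[ℝ] E)) ((Ad (γ t) : E →L[ℝ] E) * adMap E D ξ) t := by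
  have h1 := (hasModelDerivAt_Ad (E := E) (D := D)).comp (hasModelDerivAt_inv_mul_curve h)
    (inv_mul_cancel _)
  have h2 := (hasModelDerivAt_iff_hasFDerivAt.1 h1).hasDerivAt.const_mul (Ad (γ t) : E →L[ℝ] E)
  have e1 : (fun s => (Ad (γ s) : E →L[ℝ] E)) = fun s => Ad (γ t) * Ad ((γ t)⁻¹ * γ s) := by
    funext s
    have : γ s = γ t * ((γ t)⁻¹ * γ s) := by simp
    conv_lhs => rw [this, Ad_mul]
    rfl
  have e2 : (Ad (γ t) : E →L[ℝ] E) * adMap E D ξ =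
      Ad (γ t) * (adMap E D ∘L (1 : ℝ →L[ℝ] ℝ).smulRight ξ) 1 := by simp
  rw [e1, e2]
  exact h2

/-- Along a local integral curve of a left-invariant vector field, the adjoint representation is
an exponential. -/
theorem Ad_curve_eq_exp [CompleteSpace E] {γ : ℝ → D} {ξ : E} {ε : ℝ} (h0 : γ 0 = 1)
    (h : ∀ t ∈ Set.Ioo (-ε) ε, HasModelDerivAt γ t
      ((1 : ℝ →L[ℝ] ℝ).smulRight ((modelDeriv (fun g : D => γ t * g) 1 : E →L[ℝ] E) ξ)))
    {t : ℝ} (ht : t ∈ Set.Ioo (-ε) ε) :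
    (Ad (γ t) : E →L[ℝ] E) = NormedSpace.exp (t • adMap E D ξ) := by
  set A := adMap E D ξ
  -- `Ad (γ s) exp(-s A)` has zero derivative
  have h1 : ∀ s ∈ Set.Ioo (-ε) ε, HasDerivAt
      (fun s => (Ad (γ s) : E →L[ℝ] E) * NormedSpace.exp (s • (-A))) 0 s := by
    intro s hs
    have h2 := (hasDerivAt_Ad_curve (h s hs)).mul (hasDerivAt_exp_smul_const' (𝕂 := ℝ) (-A) s)
    have h3 : (Ad (γ s) : E →L[ℝ] E) * A * NormedSpace.exp (s • (-A)) +
        Ad (γ s) * (-A * NormedSpace.exp (s • (-A))) = 0 := by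
      rw [mul_assoc, ← mul_add, neg_mul, add_neg_cancel, mul_zero]
    rw [← h3]
    exact h2
  let _ : NormedAlgebra ℚ (E →L[ℝ] E) := NormedAlgebra.restrictScalars ℚ ℝ (E →L[ℝ] E)
  have h0ε : (0 : ℝ) ∈ Set.Ioo (-ε) ε := by
    constructor <;> linarith [ht.1, ht.2]
  have h2 := (convex_Ioo (-ε) ε).is_const_of_fderivWithin_eq_zero (𝕜 := ℝ)
    (fun s hs => (h1 s hs).differentiableAt.differentiableWithinAt)
    (fun s hs => by
      rw [fderivWithin_of_isOpen isOpen_Ioo hs, (h1 s hs).hasFDerivAt.fderiv]; ext; simp) ht h0ε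
  have h3 : NormedSpace.exp (t • (-A)) * NormedSpace.exp (t • A) = 1 := by
    have : Commute (t • (-A)) (t • A) := by
      rw [smul_neg]; exact (Commute.refl _).neg_left
    rw [← NormedSpace.exp_add_of_commute this]
    simp
  have h4 := congrArg (· * NormedSpace.exp (t • A)) h2
  simp only [mul_assoc, h3, h0, Ad_one] at h4
  rw [mul_one] at h4
  rw [h4]
  simp [ContinuousLinearMap.one_def]
  exact one_mul (NormedSpace.exp (t • A))

end AdjointFlow

/-! ### Density of the elements in general position -/

section Density

variable {E : Type*} [NormedAddCommGroup E] [NormedSpace ℝ E]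
  {D : Type*} [TopologicalSpace D] [ChartedSpace E D] [Group D] [LieGroup 𝓘(ℝ, E) ∞ D]

/-- An integral curve of a left-invariant vector field is continuously differentiable, since the
field is continuous in the chart. -/
theorem contMDiffAt_integralCurve {γ : ℝ → D} {ξ : E} (h0 : γ 0 = 1)
    (h : ∀ᶠ t in nhds (0 : ℝ), HasModelDerivAt γ t
      ((1 : ℝ →L[ℝ] ℝ).smulRight ((modelDeriv (fun g : D => γ t * g) 1 : E →L[ℝ] E) ξ))) :
    ContMDiffAt 𝓘(ℝ, ℝ) 𝓘(ℝ, E) 1 γ 0 := by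
  set c := extChartAt 𝓘(ℝ, E) (1 : D) with hc
  have : IsManifold 𝓘(ℝ, E) 1 D := IsManifold.of_le (n := ∞) (by simp)
  have hcont : ContinuousAt γ 0 := h.self_of_nhds.mdifferentiableAt.continuousAt
  have hcγ : ContinuousAt (fun t => (c (γ t), c 1)) 0 :=
    ((continuousAt_extChartAt' (by simp [h0])).comp hcont).prodMk continuousAt_const
  have hM : ∀ᶠ p in nhds (c 1, c 1), ContinuousAt (fderiv ℝ (chartMul E D)) p := by
    filter_upwards [((contDiffAt_chartMul (E := E) (D := D)).of_le (m := 1) (by simp)).eventually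
      (by simp)] with p hp
    exact (hp.fderiv_right (m := 0) (by simp)).continuousAt
  have hsrc : ∀ᶠ t in nhds (0 : ℝ), γ t ∈ c.source :=
    hcont.preimage_mem_nhds (by rw [h0]; exact extChartAt_source_mem_nhds 1)
  have hM' : ∀ᶠ t in nhds (0 : ℝ), ContinuousAt (fderiv ℝ (chartMul E D)) (c (γ t), c 1) := by
    have := hcγ.tendsto
    rw [h0] at this
    exact this.eventually hM
  have hV : ∀ᶠ t in nhds (0 : ℝ), ∀ η : E, (modelDeriv c (c.symm (c (γ t))) : E →L[ℝ] E)
        (modelDeriv (fun g : D => c.symm (c (γ t)) * g) 1 η) =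
      fderiv ℝ (chartMul E D) (c (γ t), c 1) (0, η) := by
    have : Filter.Tendsto (fun t => c (γ t)) (nhds 0) (nhds (c 1)) := by
      have := (ContinuousAt.comp (g := c) (continuousAt_extChartAt' (by simp [h0])) hcont).tendsto
      rwa [Function.comp_apply, h0] at this
    exact this.eventually mulInvariantVectorField_chart
  have hall := h.and (hsrc.and (hM'.and hV))
  have key : ContDiffAt ℝ 1 (fun t => c (γ t)) 0 := by
    rw [contDiffAt_one_iff]
    refine ⟨fun t => (1 : ℝ →L[ℝ] ℝ).smulRight (fderiv ℝ (chartMul E D) (c (γ t), c 1) (0, ξ)),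
      _, hall, ?_, ?_⟩
    · intro t ht
      obtain ⟨h1, h2, h3, h4⟩ := ht
      refine ContinuousAt.continuousWithinAt ?_
      have h5 : ContinuousAt (fun s => (c (γ s), c 1)) t :=
        ((continuousAt_extChartAt' h2).comp h1.mdifferentiableAt.continuousAt).prodMk
          continuousAt_const
      have h6 : ContinuousAt (fun s => fderiv ℝ (chartMul E D) (c (γ s), c 1)) t :=
        ContinuousAt.comp (f := fun s => (c (γ s), c 1)) h3 h5
      exact ((ContinuousLinearMap.smulRightL ℝ ℝ E (1 : ℝ →L[ℝ] ℝ)).continuous.continuousAt).comp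
        (h6.clm_apply continuousAt_const)
    · rintro t ⟨h1, h2, h3, h4⟩
      have h5 : HasModelDerivAt c (γ t) (modelDeriv c (γ t) : E →L[ℝ] E) :=
        hasModelDerivAt_modelDeriv (mdifferentiableAt_extChartAt (by
          rwa [← extChartAt_source 𝓘(ℝ, E)]))
      have h6 := hasModelDerivAt_iff_hasFDerivAt.1 (h5.comp h1 rfl)
      rw [c.left_inv h2] at h4
      convert h6 using 1
      ext
      simp [h4]
  have h7 : ContMDiffAt 𝓘(ℝ, ℝ) 𝓘(ℝ, E) 1 (fun t => c.symm (c (γ t))) 0 := by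
    refine ContMDiffAt.comp (g := c.symm) (f := fun t => c (γ t)) 0 ?_ key.contMDiffAt
    rw [h0]
    exact (contMDiffAt_extChartAt_symm (mem_extChartAt_target 1)).of_le (by simp)
  refine h7.congr_of_eventuallyEq ?_
  filter_upwards [hsrc] with t ht
  rw [c.left_inv ht]

/-- A submonoid containing small pieces of curves through the identity whose velocities span the
Lie algebra is a neighbourhood of the identity. -/
theorem submonoid_mem_nhds_one [FiniteDimensional ℝ E] (H : Submonoid D)
    {n : ℕ} (b : Module.Basis (Fin n) ℝ E) (γ : Fin n → ℝ → D)
    (h0 : ∀ i, γ i 0 = 1) (hγ : ∀ i, ContMDiffAt 𝓘(ℝ, ℝ) 𝓘(ℝ, E) 1 (γ i) 0)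
    (hb : ∀ i, HasModelDerivAt (γ i) 0 ((1 : ℝ →L[ℝ] ℝ).smulRight (b i)))
    (hH : ∀ i, ∀ᶠ t in nhds (0 : ℝ), γ i t ∈ H) : (H : Set D) ∈ nhds (1 : D) := by
  have : IsManifold 𝓘(ℝ, E) 1 D := IsManifold.of_le (n := ∞) (by simp)
  set c := extChartAt 𝓘(ℝ, E) (1 : D) with hc
  -- the product of the curves with independent parameters is a submersion at the origin
  let Φ : List (Fin n) → (Fin n → ℝ) → D := fun l t => (l.map fun i => γ i (t i)).prod
  have hΦ0 : ∀ l, Φ l 0 = 1 := by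
    intro l
    simp [Φ, h0]
  have hΦ : ∀ l, ContMDiffAt 𝓘(ℝ, Fin n → ℝ) 𝓘(ℝ, E) 1 (Φ l) 0 := by
    intro l
    induction l with
    | nil => exact contMDiffAt_const
    | cons i l ih =>
      have h1 : ContMDiffAt 𝓘(ℝ, Fin n → ℝ) 𝓘(ℝ, E) 1 (fun t : Fin n → ℝ => γ i (t i)) 0 :=
        ContMDiffAt.comp (g := γ i) (f := fun t : Fin n → ℝ => t i) 0 (hγ i)
          (contDiff_apply ℝ ℝ i).contDiffAt.contMDiffAt
      exact (h1.mul ih).congr_of_eventuallyEq (Filter.Eventually.of_forall fun t => by simp [Φ])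
  set Ψ := Φ (List.finRange n) with hΨ
  have hcΨ : ContDiffAt ℝ 1 (fun t => c (Ψ t)) 0 := by
    rw [← contMDiffAt_iff_contDiffAt]
    exact ((contMDiffAt_chart_one (hΦ0 _)).of_le (by simp)).comp 0 (hΦ _)
  have hstrict := hcΨ.hasStrictFDerivAt (by simp)
  have hsurj : (fderiv ℝ (fun t => c (Ψ t)) 0).range = ⊤ := by
    rw [eq_top_iff, ← b.span_eq, Submodule.span_le]
    rintro _ ⟨i, rfl⟩
    refine ⟨Pi.single i 1, ?_⟩
    have h1 : HasFDerivAt (fun s : ℝ => (Pi.single i s : Fin n → ℝ))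
      (ContinuousLinearMap.single ℝ (fun _ : Fin n => ℝ) i) 0 :=
      (ContinuousLinearMap.single ℝ (fun _ : Fin n => ℝ) i).hasFDerivAt
    have h2 : HasFDerivAt (fun t => c (Ψ t)) (fderiv ℝ (fun t => c (Ψ t)) 0)
        (Pi.single i (0 : ℝ)) := by
      rw [Pi.single_zero]
      exact (hcΨ.differentiableAt (by simp)).hasFDerivAt
    have h3 := h2.comp (0 : ℝ) h1
    have h4 : (fun t => c (Ψ t)) ∘ (fun s : ℝ => (Pi.single i s : Fin n → ℝ)) =
        fun s => c (γ i s) := by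
      funext s
      have h5 := List.prod_map_eq_pow_single (l := List.finRange n) i
        (fun j => γ j ((Pi.single i s : Fin n → ℝ) j)) (by
          intro j hj _
          simp [hj, h0])
      have h6 : (List.finRange n).count i = 1 :=
        List.count_eq_one_of_mem (List.nodup_finRange n) (List.mem_finRange i)
      rw [h6, pow_one] at h5
      simp only [Function.comp_apply]
      congr 1
      simpa using h5
    rw [h4] at h3
    have h5 := h3.unique (hasModelDerivAt_iff_hasFDerivAt.1
      ((hasModelDerivAt_extChartAt_self (1 : D)).comp (hb i) (h0 i)))
    have h6 := congrArg (fun L : ℝ →L[ℝ] E => L 1) h5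
    simpa using h6
  have hmap := hstrict.map_nhds_eq_of_surj hsurj
  have h1 : ∀ᶠ t in nhds (0 : Fin n → ℝ), Ψ t ∈ c.source ∧ ∀ i, γ i (t i) ∈ H := by
    refine Filter.Eventually.and ((hΦ _).continuousAt.preimage_mem_nhds ?_) ?_
    · rw [hΦ0]; exact extChartAt_source_mem_nhds 1
    · rw [Filter.eventually_all]
      intro i
      exact ((continuous_apply i).tendsto (0 : Fin n → ℝ)).eventually (hH i)
  have h2 := Filter.image_mem_map (m := fun t => c (Ψ t)) h1
  rw [hmap, show Ψ 0 = 1 from hΦ0 _] at h2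
  filter_upwards [extChartAt_source_mem_nhds (I := 𝓘(ℝ, E)) (1 : D),
    (continuousAt_extChartAt (I := 𝓘(ℝ, E)) (1 : D)).preimage_mem_nhds h2] with x hx hx'
  obtain ⟨t, ⟨ht1, ht2⟩, ht3⟩ := hx'
  have h3 : x = Ψ t := (c.injOn ht1 hx ht3).symm
  rw [h3]
  refine H.list_prod_mem fun y hy => ?_
  obtain ⟨i, -, rfl⟩ := List.mem_map.1 hy
  exact ht2 i

/-- A nonzero analytic function of the adjoint representation of a connected Lie group does not
vanish on a nonempty open set. The group `D` is only assumed smooth, so analyticity is used along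
the integral curves `γ` of left-invariant vector fields, where `Ad (x γ(t)) = Ad x exp(t ad ξ)`. -/
theorem dense_Ad_ne_zero [FiniteDimensional ℝ E] [ConnectedSpace D] (F : (E →L[ℝ] E) → ℝ)
    (hF : AnalyticOnNhd ℝ F Set.univ) (h1 : F (ContinuousLinearMap.id ℝ E) ≠ 0) :
    Dense {x : D | F (Ad x) ≠ 0} := by
  have : CompleteSpace E := FiniteDimensional.complete ℝ E
  have : IsTopologicalGroup D := topologicalGroup_of_lieGroup 𝓘(ℝ, E) ∞
  set U := interior {x : D | F (Ad x) = 0} with hU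
  -- right translation by elements near the identity preserves the interior of the zero set,
  -- which is therefore open and closed
  let H : Submonoid D :=
    { carrier := {y | ∀ x ∈ U, x * y ∈ U}
      mul_mem' := fun {a b} ha hb x hx => by rw [← mul_assoc]; exact hb _ (ha x hx)
      one_mem' := fun x hx => by simpa using hx }
  choose γ h0 hγ using fun i => exists_integralCurve (D := D) (Module.finBasis ℝ E i)
  have hH : (H : Set D) ∈ nhds 1 := by
    refine submonoid_mem_nhds_one H (Module.finBasis ℝ E) γ h0
      (fun i => contMDiffAt_integralCurve (h0 i) (hγ i)) (fun i => ?_) (fun i => ?_)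
    · have h2 := (hγ i).self_of_nhds
      have h3 : (modelDeriv (fun g : D => γ i 0 * g) 1 : E →L[ℝ] E) =
          ContinuousLinearMap.id ℝ E := by
        rw [h0]
        simpa using (hasModelDerivAt_id (E := E) (1 : D)).modelDeriv_eq
      rw [h3] at h2
      exact h2
    · obtain ⟨ε, hε, hball⟩ := Metric.eventually_nhds_iff_ball.1 (hγ i)
      rw [Real.ball_eq_Ioo, zero_sub, zero_add] at hball
      have hexp := fun t ht => Ad_curve_eq_exp (h0 i) hball (t := t) ht
      filter_upwards [Ioo_mem_nhds (neg_lt_zero.2 hε) hε] with t ht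
      have hsub : (· * γ i t) '' U ⊆ {x : D | F (Ad x) = 0} := by
        rintro _ ⟨x, hx, rfl⟩
        let f : ℝ → ℝ := fun s => F (Ad x * NormedSpace.exp (s • adMap E D (Module.finBasis ℝ E i)))
        have hf : ∀ s ∈ Set.Ioo (-ε) ε, f s = F (Ad (x * γ i s)) := by
          intro s hs
          simp only [f]
          rw [Ad_mul, hexp s hs]
          rfl
        have hfa : AnalyticOnNhd ℝ f (Set.Ioo (-ε) ε) := by
          intro s _
          have ha : AnalyticAt ℝ (fun s : ℝ => (Ad x : E →L[ℝ] E) *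
              NormedSpace.exp (s • adMap E D (Module.finBasis ℝ E i))) s :=
            analyticAt_const.mul ((NormedSpace.exp_analytic (𝕂 := ℝ) _).comp
              (analyticAt_id.smul analyticAt_const))
          exact (hF _ trivial).comp ha
        have hev : f =ᶠ[nhds 0] 0 := by
          have hcont : ContinuousAt (fun s => x * γ i s) 0 :=
            continuousAt_const.mul (hγ i).self_of_nhds.mdifferentiableAt.continuousAt
          have := hcont.preimage_mem_nhds (isOpen_interior.mem_nhds
            (show x * γ i 0 ∈ U by rw [h0, mul_one]; exact hx))
          filter_upwards [this, Ioo_mem_nhds (neg_lt_zero.2 hε) hε] with s hs hs'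
          rw [hf s hs']
          exact (interior_subset hs : x * γ i s ∈ {x : D | F (Ad x) = 0})
        have := hfa.eqOn_zero_of_preconnected_of_eventuallyEq_zero isPreconnected_Ioo
          ⟨neg_lt_zero.2 hε, hε⟩ hev ht
        rw [hf t ht] at this
        exact this
      have hopen : IsOpen ((· * γ i t) '' U) := isOpenMap_mul_right _ _ isOpen_interior
      intro x hx
      exact interior_maximal hsub hopen ⟨x, hx, rfl⟩
  have hclosed : IsClosed U := by
    refine isClosed_of_closure_subset fun x hx => ?_
    have h2 : (fun u : D => u⁻¹ * x) ⁻¹' H ∈ nhds x := by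
      refine ContinuousAt.preimage_mem_nhds (by fun_prop) ?_
      rwa [inv_mul_cancel]
    obtain ⟨u, hu1, hu2⟩ := mem_closure_iff_nhds.1 hx _ h2
    have := hu1 u hu2
    rwa [mul_inv_cancel_left] at this
  have hempty : U = ∅ := by
    rcases isClopen_iff.1 ⟨hclosed, isOpen_interior⟩ with h | h
    · exact h
    · have : (1 : D) ∈ U := h ▸ trivial
      have := interior_subset this
      rw [Set.mem_ofPred_eq, Ad_one] at this
      exact absurd this h1
  rw [interior_eq_empty_iff_dense_compl] at hempty
  exact hempty

theorem analyticOnNhd_det [FiniteDimensional ℝ E] :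
    AnalyticOnNhd ℝ (fun T : E →L[ℝ] E => LinearMap.det (T : E →ₗ[ℝ] E)) Set.univ := by
  intro T _
  set b := Module.finBasis ℝ E
  have h : (fun T : E →L[ℝ] E => LinearMap.det (T : E →ₗ[ℝ] E)) = fun T =>
      ∑ σ : Equiv.Perm (Fin (Module.finrank ℝ E)), ((Equiv.Perm.sign σ : ℤ) : ℝ) *
        ∏ i, (LinearMap.toContinuousLinearMap (b.coord (σ i)))
          (ContinuousLinearMap.apply ℝ E (b i) T) := by
    funext T
    rw [← LinearMap.det_toMatrix b, Matrix.det_apply']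
    simp [LinearMap.toMatrix_apply]
  rw [h]
  refine Finset.analyticAt_fun_sum _ fun σ _ => analyticAt_const.mul ?_
  refine Finset.analyticAt_fun_prod _ fun i _ => ?_
  exact ((LinearMap.toContinuousLinearMap (b.coord (σ i))) ∘L
    (ContinuousLinearMap.apply ℝ E (b i))).analyticAt T

/-- For a projection `P` with range `𝔨`, the endomorphism `P ∘ Ad x` of `𝔨` is onto for a dense set
of elements `x` of a connected Lie group. -/
theorem dense_proj_Ad_surjOn [FiniteDimensional ℝ E] [ConnectedSpace D] (P : E →L[ℝ] E)
    (hP : ∀ v, P (P v) = P v) :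
    Dense {x : D | ∀ v, ∃ w, P ((Ad x : E →L[ℝ] E) (P w)) = P v} := by
  -- `Q T` is block triangular for the splitting by `P`, so it is invertible exactly when `P T`
  -- maps the range of `P` onto itself
  let Q : (E →L[ℝ] E) → (E →L[ℝ] E) := fun T => P * T * P + (1 - P)
  have hQ : AnalyticOnNhd ℝ Q Set.univ := fun T _ =>
    ((analyticAt_const.mul analyticAt_id).mul analyticAt_const).add analyticAt_const
  have hF : AnalyticOnNhd ℝ (fun T => LinearMap.det ((Q T : E →L[ℝ] E) : E →ₗ[ℝ] E)) Set.univ :=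
    fun T _ => (analyticOnNhd_det (Q T) trivial).comp (hQ T trivial)
  refine (dense_Ad_ne_zero (D := D) _ hF ?_).mono ?_
  · have : Q (ContinuousLinearMap.id ℝ E) = 1 := by
      ext v
      simp [Q, hP]
    rw [this]
    simp
  · intro x hx v
    have h1 : Function.Surjective ((Q (Ad x) : E →L[ℝ] E) : E →ₗ[ℝ] E) :=
      ((Module.End.isUnit_iff _).1 ((LinearMap.isUnit_iff_isUnit_det _).2
        (isUnit_iff_ne_zero.2 hx))).2
    obtain ⟨w, hw⟩ := h1 (P v)
    refine ⟨w, ?_⟩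
    have h2 := congrArg P hw
    simpa [Q, hP] using h2

end Density

/-! ### Slices and invariant functions of a closed subgroup -/

section Slice

open scoped Pointwise

/-- A smooth form of the inverse function theorem: near a point with invertible derivative, the
local inverse of a map that is smooth on a neighbourhood is smooth on a neighbourhood. -/
theorem exists_openPartialHomeomorph_contDiffAt_symm
    {X : Type*} [NormedAddCommGroup X] [NormedSpace ℝ X] [CompleteSpace X]
    {Y : Type*} [NormedAddCommGroup Y] [NormedSpace ℝ Y] {f : X → Y} {a : X} (f' : X ≃L[ℝ] Y)
    (hf : ∀ᶠ x in nhds a, ContDiffAt ℝ ∞ f x) (hf' : HasFDerivAt f (f' : X →L[ℝ] Y) a) :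
    ∃ R : OpenPartialHomeomorph X Y, (R : X → Y) = f ∧ a ∈ R.source ∧
      ∀ᶠ x in nhds a, ContDiffAt ℝ ∞ R.symm (f x) := by
  have h0 := hf.self_of_nhds
  refine ⟨h0.toOpenPartialHomeomorph f hf' (by simp), rfl,
    h0.mem_toOpenPartialHomeomorph_source hf' (by simp), ?_⟩
  set R := h0.toOpenPartialHomeomorph f hf' (by simp) with hR
  have h1 : ContinuousAt (fderiv ℝ f) a :=
    (h0.fderiv_right (m := 0) (by simp)).continuousAt
  have h2 : ∀ᶠ x in nhds a, fderiv ℝ f x ∈ Set.range ((↑) : (X ≃L[ℝ] Y) → X →L[ℝ] Y) := by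
    refine h1.preimage_mem_nhds ?_
    rw [hf'.fderiv]
    exact ContinuousLinearEquiv.nhds f'
  filter_upwards [hf, h2, R.open_source.mem_nhds
    (h0.mem_toOpenPartialHomeomorph_source hf' (by simp))] with x hx1 hx2 hx3
  obtain ⟨e, he⟩ := hx2
  have h3 : R.symm (f x) = x := R.left_inv hx3
  refine R.contDiffAt_symm (f₀' := e) (R.map_source hx3) ?_ ?_
  · rw [h3, he]
    exact (hx1.differentiableAt (by simp)).hasFDerivAt
  · rw [h3]
    exact hx1

variable {E : Type*} [NormedAddCommGroup E] [NormedSpace ℝ E]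
  {D : Type*} [TopologicalSpace D] [ChartedSpace E D] [Group D]
  {V : Type*} [NormedAddCommGroup V] [NormedSpace ℝ V]
  {G : Type*} [TopologicalSpace G] [ChartedSpace V G] [Group G]

/-- The parametrization `(s, v) ↦ σ(s) ι(h(v))` of a neighbourhood of the identity by a slice
and a subgroup. -/
def sliceMap (S : Submodule ℝ E) (ι : G →* D) (p : S × V) : D :=
  (extChartAt 𝓘(ℝ, E) (1 : D)).symm (extChartAt 𝓘(ℝ, E) (1 : D) 1 + p.1) *
    ι ((extChartAt 𝓘(ℝ, V) (1 : G)).symm (extChartAt 𝓘(ℝ, V) (1 : G) 1 + p.2))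

theorem sliceMap_zero {S : Submodule ℝ E} {ι : G →* D} :
    sliceMap S ι (0 : S × V) = 1 := by
  simp [sliceMap]

theorem sliceMap_zero_right {S : Submodule ℝ E} {ι : G →* D} (s : S) :
    sliceMap S ι (s, (0 : V)) =
      (extChartAt 𝓘(ℝ, E) (1 : D)).symm (extChartAt 𝓘(ℝ, E) (1 : D) 1 + s) := by
  simp [sliceMap]

variable [LieGroup 𝓘(ℝ, E) ∞ D] [LieGroup 𝓘(ℝ, V) ∞ G]

theorem contMDiffAt_sliceMap {S : Submodule ℝ E} {ι : G →* D}
    (hι : ContMDiff 𝓘(ℝ, V) 𝓘(ℝ, E) ∞ ι) {p : S × V}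
    (h1 : extChartAt 𝓘(ℝ, E) (1 : D) 1 + p.1 ∈ (extChartAt 𝓘(ℝ, E) (1 : D)).target)
    (h2 : extChartAt 𝓘(ℝ, V) (1 : G) 1 + p.2 ∈ (extChartAt 𝓘(ℝ, V) (1 : G)).target) :
    ContMDiffAt 𝓘(ℝ, S × V) 𝓘(ℝ, E) ∞ (sliceMap S ι) p := by
  have h3 : ContDiff ℝ ∞ (fun p : S × V => extChartAt 𝓘(ℝ, E) (1 : D) 1 + (p.1 : E)) :=
    contDiff_const.add (S.subtypeL.contDiff.comp contDiff_fst)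
  have h4 : ContDiff ℝ ∞ (fun p : S × V => extChartAt 𝓘(ℝ, V) (1 : G) 1 + p.2) :=
    contDiff_const.add contDiff_snd
  have h5 : ContMDiffAt 𝓘(ℝ, S × V) 𝓘(ℝ, E) ∞ (fun p : S × V =>
      (extChartAt 𝓘(ℝ, E) (1 : D)).symm (extChartAt 𝓘(ℝ, E) (1 : D) 1 + p.1)) p :=
    ContMDiffAt.comp p (contMDiffAt_extChartAt_symm h1) h3.contMDiff.contMDiffAt
  have h6 : ContMDiffAt 𝓘(ℝ, S × V) 𝓘(ℝ, V) ∞ (fun p : S × V =>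
      (extChartAt 𝓘(ℝ, V) (1 : G)).symm (extChartAt 𝓘(ℝ, V) (1 : G) 1 + p.2)) p :=
    ContMDiffAt.comp p (contMDiffAt_extChartAt_symm h2) h4.contMDiff.contMDiffAt
  exact h5.mul (ContMDiffAt.comp p hι.contMDiffAt h6)

theorem hasFDerivAt_chart_sliceMap {S : Submodule ℝ E} {ι : G →* D}
    (hι : ContMDiff 𝓘(ℝ, V) 𝓘(ℝ, E) ∞ ι) :
    HasFDerivAt (fun p : S × V => extChartAt 𝓘(ℝ, E) (1 : D) (sliceMap S ι p))
      (S.subtypeL.coprod (modelDeriv ι 1 : V →L[ℝ] E)) 0 := by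
  set c := extChartAt 𝓘(ℝ, E) (1 : D)
  set cG := extChartAt 𝓘(ℝ, V) (1 : G)
  have h1 : ContMDiffAt 𝓘(ℝ, S × V) 𝓘(ℝ, E) ∞ (fun p => c (sliceMap S ι p)) (0 : S × V) :=
    (contMDiffAt_chart_one sliceMap_zero).comp 0 (contMDiffAt_sliceMap hι
      (by simp) (by simp))
  have h2 := (h1.contDiffAt.differentiableAt (by simp)).hasFDerivAt
  have h3 : (fderiv ℝ (fun p : S × V => c (sliceMap S ι p)) 0).comp
      (ContinuousLinearMap.inl ℝ S V) = S.subtypeL := by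
    have h4 : HasFDerivAt (fun s : S => (s, (0 : V))) (ContinuousLinearMap.inl ℝ S V) 0 :=
      hasFDerivAt_prodMk_left 0 0
    have h5 := HasFDerivAt.comp (f := fun s : S => (s, (0 : V))) 0 h2 h4
    have h6 : HasFDerivAt (fun s : S => c 1 + (s : E)) S.subtypeL 0 :=
      S.subtypeL.hasFDerivAt.const_add (c 1)
    refine h5.unique (h6.congr_of_eventuallyEq ?_)
    have h7 : Filter.Tendsto (fun s : S => c 1 + (s : E)) (nhds 0) (nhds (c 1)) := by
      have : Continuous (fun s : S => c 1 + (s : E)) := by fun_prop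
      simpa using this.tendsto 0
    filter_upwards [h7.eventually (extChartAt_target_mem_nhds (I := 𝓘(ℝ, E)) (1 : D))] with s hs
    change c (sliceMap S ι (s, (0 : V))) = c 1 + (s : E)
    rw [sliceMap_zero_right, c.right_inv hs]
  have h4 : (fderiv ℝ (fun p : S × V => c (sliceMap S ι p)) 0).comp
      (ContinuousLinearMap.inr ℝ S V) = (modelDeriv ι 1 : V →L[ℝ] E) := by
    have h4 : HasFDerivAt (fun v : V => ((0 : S), v)) (ContinuousLinearMap.inr ℝ S V) 0 :=
      hasFDerivAt_prodMk_right 0 0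
    have h5 := HasFDerivAt.comp (f := fun v : V => ((0 : S), v)) 0 h2 h4
    have h6 : HasFDerivAt (fun v : V => cG 1 + v) (ContinuousLinearMap.id ℝ V) 0 :=
      (hasFDerivAt_id _).const_add (cG 1)
    have h7 : HasModelDerivAt ι (1 : G) (modelDeriv ι 1 : V →L[ℝ] E) :=
      hasModelDerivAt_modelDeriv (hι.mdifferentiable (by simp) 1)
    have h8 := (hasModelDerivAt_extChartAt_self (1 : D)).comp (h7.comp
      ((hasModelDerivAt_extChartAt_symm_self (1 : G)).comp
        (hasModelDerivAt_iff_hasFDerivAt.2 h6) (add_zero _)) (by simp [cG])) (by simp [cG])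
    have h9 := hasModelDerivAt_iff_hasFDerivAt.1 h8
    simp only [ContinuousLinearMap.comp_id, ContinuousLinearMap.id_comp] at h9
    refine h5.unique (h9.congr_of_eventuallyEq (Filter.Eventually.of_forall fun v => ?_))
    simp [sliceMap, c, cG]
  have h5 : fderiv ℝ (fun p : S × V => c (sliceMap S ι p)) 0 =
      S.subtypeL.coprod (modelDeriv ι 1 : V →L[ℝ] E) := by
    rw [← h3, ← h4]
    ext <;> simp
  rw [← h5]
  exact h2

variable [FiniteDimensional ℝ E] [FiniteDimensional ℝ V]

/-- An embedded subgroup has a smooth local slice: a piece of submanifold through the identity that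
meets each coset at most once, with a smooth projection along the cosets. -/
theorem exists_slice {ι : G →* D} (hι : ContMDiff 𝓘(ℝ, V) 𝓘(ℝ, E) ∞ ι)
    (hemb : Topology.IsEmbedding ι)
    (hinj : Function.Injective (modelDeriv ι 1 : V →L[ℝ] E)) (S : Submodule ℝ E)
    (hS : IsCompl S (LinearMap.range ((modelDeriv ι 1 : V →L[ℝ] E) : V →ₗ[ℝ] E))) :
    ∃ (σ : S → D) (ε : ℝ), 0 < ε ∧ σ 0 = 1 ∧ HasModelDerivAt σ 0 S.subtypeL ∧
      ContinuousOn σ (Metric.ball 0 ε) ∧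
      (∀ s ∈ Metric.ball (0 : S) ε, ∀ s' ∈ Metric.ball (0 : S) ε, ∀ k : G,
        σ s = σ s' * ι k → s = s') ∧
      ∀ s ∈ Metric.ball (0 : S) ε, ∃ p : D → S, ContMDiffAt 𝓘(ℝ, E) 𝓘(ℝ, S) ∞ p (σ s) ∧
        p (σ s) = s ∧ ∀ᶠ y in nhds (σ s), ∃ k, y = σ (p y) * ι k := by
  have : CompleteSpace E := FiniteDimensional.complete ℝ E
  have : CompleteSpace V := FiniteDimensional.complete ℝ V
  have : CompleteSpace S := FiniteDimensional.complete ℝ S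
  have : IsTopologicalGroup D := topologicalGroup_of_lieGroup 𝓘(ℝ, E) ∞
  set c := extChartAt 𝓘(ℝ, E) (1 : D) with hc
  set cG := extChartAt 𝓘(ℝ, V) (1 : G) with hcG
  let σ : S → D := fun s => c.symm (c 1 + s)
  have hσ0 : σ 0 = 1 := by simp [σ, c]
  have hσΨ : ∀ s, sliceMap S ι (s, (0 : V)) = σ s := by
    exact sliceMap_zero_right
  -- the derivative of the slice map is an isomorphism
  let L : S × V →L[ℝ] E := S.subtypeL.coprod (modelDeriv ι 1 : V →L[ℝ] E)
  have hL : Function.Bijective L := by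
    constructor
    · rw [injective_iff_map_eq_zero]
      rintro ⟨s, v⟩ h
      have h1 : (s : E) = -(modelDeriv ι 1 : V →L[ℝ] E) v := by
        simpa [L, add_eq_zero_iff_eq_neg] using h
      have h2 : (s : E) ∈ (⊥ : Submodule ℝ E) := by
        rw [← hS.inf_eq_bot]
        exact ⟨s.2, -v, by rw [h1]; simp⟩
      rw [Submodule.mem_bot] at h2
      rw [h2] at h1
      have h3 : v = 0 := hinj (by rw [map_zero]; exact (neg_eq_zero.1 h1.symm))
      simp [h3, Submodule.coe_eq_zero.1 h2]
    · intro x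
      have hx : x ∈ S ⊔ LinearMap.range ((modelDeriv ι 1 : V →L[ℝ] E) : V →ₗ[ℝ] E) := by
        rw [hS.sup_eq_top]; trivial
      obtain ⟨s, hs, _, ⟨v, rfl⟩, rfl⟩ := Submodule.mem_sup.1 hx
      exact ⟨(⟨s, hs⟩, v), by simp [L]⟩
  let Le : (S × V) ≃L[ℝ] E :=
    (LinearEquiv.ofBijective (L : S × V →ₗ[ℝ] E) hL).toContinuousLinearEquiv
  have hLe : (Le : S × V →L[ℝ] E) = L := by ext <;> rfl
  -- smoothness of the slice map near the origin
  have hT : ∀ᶠ p in nhds (0 : S × V), c 1 + (p.1 : E) ∈ c.target := by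
    have h1 : Continuous (fun p : S × V => c 1 + (p.1 : E)) := by fun_prop
    have h2 : c 1 + ((0 : S × V).1 : E) = c 1 := by simp
    exact h1.continuousAt.preimage_mem_nhds (by rw [h2]; exact extChartAt_target_mem_nhds 1)
  have hTG : ∀ᶠ p in nhds (0 : S × V), cG 1 + p.2 ∈ cG.target := by
    have h1 : Continuous (fun p : S × V => cG 1 + p.2) := by fun_prop
    have h2 : cG 1 + (0 : S × V).2 = cG 1 := by simp
    exact h1.continuousAt.preimage_mem_nhds (by rw [h2]; exact extChartAt_target_mem_nhds 1)
  have hΨ : ∀ᶠ p in nhds (0 : S × V), ContMDiffAt 𝓘(ℝ, S × V) 𝓘(ℝ, E) ∞ (sliceMap S ι) p := by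
    filter_upwards [hT, hTG] with p h1 h2
    exact contMDiffAt_sliceMap hι h1 h2
  have hΨs : ∀ᶠ p in nhds (0 : S × V), sliceMap S ι p ∈ c.source :=
    hΨ.self_of_nhds.continuousAt.preimage_mem_nhds (by
      rw [sliceMap_zero]; exact extChartAt_source_mem_nhds 1)
  have hcΨ : ∀ᶠ p in nhds (0 : S × V), ContDiffAt ℝ ∞ (fun p : S × V => c (sliceMap S ι p)) p := by
    filter_upwards [hΨ, hΨs] with p h1 h2
    exact (ContMDiffAt.comp (g := c) p (contMDiffAt_extChartAt' (by
      rwa [← extChartAt_source 𝓘(ℝ, E)])) h1).contDiffAt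
  obtain ⟨R, hRc, hR0, hRs⟩ := exists_openPartialHomeomorph_contDiffAt_symm Le hcΨ
    (by rw [hLe]; exact hasFDerivAt_chart_sliceMap hι)
  have hR1 : ∀ᶠ p in nhds (0 : S × V), p ∈ R.source := R.open_source.mem_nhds hR0
  have hall := hR1.and (hRs.and (hT.and (hTG.and (hΨ.and hΨs))))
  obtain ⟨ε₀, hε₀, hball⟩ := Metric.eventually_nhds_iff_ball.1 hall
  -- an element of the subgroup close to the identity in `D` is close to the identity in `G`
  have hG : ∀ᶠ k in nhds (1 : G), k ∈ cG.source ∧ ‖cG k - cG 1‖ < ε₀ := by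
    have h0 : ∀ᶠ k in nhds (1 : G), k ∈ cG.source := extChartAt_source_mem_nhds 1
    refine h0.and ?_
    have h1 : ContinuousAt (fun k => ‖cG k - cG 1‖) 1 :=
      ((continuousAt_extChartAt (I := 𝓘(ℝ, V)) (1 : G)).sub continuousAt_const).norm
    exact h1.eventually (gt_mem_nhds (by simpa using hε₀))
  rw [hemb.isInducing.nhds_eq_comap, map_one] at hG
  obtain ⟨W, hW, hWG⟩ := Filter.eventually_comap.1 hG |>.exists_mem
  have hσc : ∀ s : S, ‖s‖ < ε₀ → ContinuousAt σ s := by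
    intro s hs
    have h1 := (hball (s, 0) (by simpa using hs)).2.2.2.2.1.continuousAt
    have h2 : ContinuousAt (fun s : S => (s, (0 : V))) s := by fun_prop
    have h3 : σ = sliceMap S ι ∘ (fun s : S => (s, (0 : V))) := by
      funext s; exact (hσΨ s).symm
    rw [h3]
    exact ContinuousAt.comp (f := fun s : S => (s, (0 : V))) h1 h2
  have hW' : ∀ᶠ q in nhds ((0 : S), (0 : S)), (σ q.2)⁻¹ * σ q.1 ∈ W := by
    have h1 := hσc 0 (by simpa using hε₀)
    have h2 : ContinuousAt (fun q : S × S => (σ q.2)⁻¹ * σ q.1) (0, 0) :=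
      (ContinuousAt.comp (f := fun q : S × S => q.2) (x := ((0 : S), (0 : S))) h1
        continuousAt_snd).inv.mul
        (ContinuousAt.comp (f := fun q : S × S => q.1) (x := ((0 : S), (0 : S))) h1
          continuousAt_fst)
    refine h2.preimage_mem_nhds ?_
    simpa [hσ0] using hW
  obtain ⟨ε₁, hε₁, hball₁⟩ := Metric.eventually_nhds_iff_ball.1 hW'
  refine ⟨σ, min ε₀ ε₁, lt_min hε₀ hε₁, hσ0, ?_, ?_, ?_, ?_⟩
  · have h1 : HasFDerivAt (fun s : S => c 1 + (s : E)) S.subtypeL 0 :=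
      S.subtypeL.hasFDerivAt.const_add (c 1)
    have h2 := (hasModelDerivAt_extChartAt_symm_self (1 : D)).comp
      (hasModelDerivAt_iff_hasFDerivAt.2 h1) (by simp [c])
    rwa [ContinuousLinearMap.id_comp] at h2
  · intro s hs
    rw [mem_ball_zero_iff, lt_min_iff] at hs
    exact (hσc s hs.1).continuousWithinAt
  · intro s hs s' hs' k hk
    rw [mem_ball_zero_iff, lt_min_iff] at hs hs'
    have h1 : (σ s')⁻¹ * σ s ∈ W := hball₁ (s, s')
      (mem_ball_zero_iff.2 (max_lt hs.2 hs'.2) : (s, s') ∈ Metric.ball (0 : S × S) ε₁)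
    obtain ⟨h2, h3⟩ := hWG _ h1 k (by rw [hk]; simp)
    have h4 : sliceMap S ι (s', cG k - cG 1) = σ s := by
      rw [hk]
      change σ s' * ι (cG.symm (cG 1 + (cG k - cG 1))) = σ s' * ι k
      rw [add_sub_cancel, cG.left_inv h2]
    have h5 : R (s', cG k - cG 1) = R (s, 0) := by
      rw [hRc]
      simp only [h4, hσΨ]
    have h6 := R.injOn (hball _ (mem_ball_zero_iff.2 (max_lt hs'.1 h3))).1
      (hball _ (mem_ball_zero_iff.2 (max_lt hs.1 (by simpa using hε₀)))).1 h5
    exact (Prod.mk.inj h6).1.symm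
  · intro s hs
    rw [mem_ball_zero_iff, lt_min_iff] at hs
    have h0 := hball (s, 0) (by simpa using hs.1)
    obtain ⟨h1, h2, h3, h4, h5, h6⟩ := h0
    have h7 : R (s, 0) = c (σ s) := by rw [hRc]; simp only [hσΨ]
    have h8 : R.symm (c (σ s)) = (s, 0) := by rw [← h7]; exact R.left_inv h1
    simp only [hσΨ] at h2 h6
    have h9 : ContMDiffAt 𝓘(ℝ, E) 𝓘(ℝ, E) ∞ c (σ s) := contMDiffAt_extChartAt' (by
      rwa [← extChartAt_source 𝓘(ℝ, E)])
    have h10 : ContMDiffAt 𝓘(ℝ, E) 𝓘(ℝ, S × V) ∞ (fun y => R.symm (c y)) (σ s) :=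
      ContMDiffAt.comp (g := R.symm) (σ s) h2.contMDiffAt h9
    refine ⟨fun y => (R.symm (c y)).1, ContMDiffAt.comp (g := Prod.fst) (σ s)
      contDiff_fst.contMDiff.contMDiffAt h10, congrArg Prod.fst h8, ?_⟩
    have h11 : ∀ᶠ y in nhds (σ s), sliceMap S ι (R.symm (c y)) ∈ c.source := by
      have : ContinuousAt (fun y => sliceMap S ι (R.symm (c y))) (σ s) := by
        refine ContinuousAt.comp (g := sliceMap S ι) (f := fun y => R.symm (c y)) ?_
          h10.continuousAt
        rw [h8]; exact h5.continuousAt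
      refine this.preimage_mem_nhds ?_
      rw [h8, hσΨ]
      exact (isOpen_extChartAt_source 1).mem_nhds h6
    have h12 : ∀ᶠ y in nhds (σ s), c y ∈ R.target :=
      h9.continuousAt.preimage_mem_nhds (R.open_target.mem_nhds (by
        rw [← h7]; exact R.map_source h1))
    filter_upwards [h11, h12, (isOpen_extChartAt_source (I := 𝓘(ℝ, E)) (1 : D)).mem_nhds h6]
      with y hy1 hy2 hy3
    refine ⟨_, (c.injOn hy1 hy3 ?_).symm⟩
    have := R.right_inv hy2
    rwa [hRc] at this

/-- For a closed subgroup, every covector at the identity that vanishes on the Lie algebra of the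
subgroup is the differential of a smooth function invariant under right translations by the
subgroup. -/
theorem exists_invariant_function {ι : G →* D} (hι : ContMDiff 𝓘(ℝ, V) 𝓘(ℝ, E) ∞ ι)
    (hemb : Topology.IsClosedEmbedding ι)
    (hinj : Function.Injective (modelDeriv ι 1 : V →L[ℝ] E)) (α : E →L[ℝ] ℝ)
    (hα : ∀ v, α ((modelDeriv ι 1 : V →L[ℝ] E) v) = 0) :
    ∃ φ : D → ℝ, ContMDiff 𝓘(ℝ, E) 𝓘(ℝ, ℝ) ∞ φ ∧ (∀ h x, φ (x * ι h) = φ x) ∧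
      HasModelDerivAt φ 1 α := by
  have : IsTopologicalGroup D := topologicalGroup_of_lieGroup 𝓘(ℝ, E) ∞
  obtain ⟨S, hS⟩ :=
    (LinearMap.range ((modelDeriv ι 1 : V →L[ℝ] E) : V →ₗ[ℝ] E)).exists_isCompl
  obtain ⟨σ, ε, hε, hσ0, hσd, hσc, hσi, hσp⟩ := exists_slice hι hemb.isEmbedding hinj S hS.symm
  have : ProperSpace S := FiniteDimensional.proper ℝ S
  -- cut off the covector on the slice, and extend by invariance and by zero
  let χ : ContDiffBump (0 : S) := ⟨ε / 3, ε / 2, by linarith, by linarith⟩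
  let f : S → ℝ := fun s => χ s * α s
  have hf : ContDiff ℝ ∞ f := χ.contDiff.mul (α.contDiff.comp S.subtypeL.contDiff)
  have hf0 : ∀ s : S, s ∉ Metric.closedBall (0 : S) (ε / 2) → f s = 0 := by
    intro s hs
    have : χ s = 0 := χ.zero_of_le_dist (not_le.1 hs).le
    simp [f, this]
  classical
  let φ : D → ℝ := fun x =>
    if h : ∃ s ∈ Metric.ball (0 : S) ε, ∃ k, x = σ s * ι k then f h.choose else 0
  have hφ : ∀ s ∈ Metric.ball (0 : S) ε, ∀ k, φ (σ s * ι k) = f s := by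
    intro s hs k
    have h : ∃ s' ∈ Metric.ball (0 : S) ε, ∃ k', σ s * ι k = σ s' * ι k' := ⟨s, hs, k, rfl⟩
    simp only [φ]
    rw [dif_pos h]
    obtain ⟨h1, k', h2⟩ := h.choose_spec
    congr 1
    refine hσi _ h1 s hs (k * k'⁻¹) ?_
    rw [map_mul, map_inv, ← mul_assoc]
    exact eq_mul_inv_of_mul_eq h2.symm
  have hφ0 : ∀ x, (∀ s ∈ Metric.closedBall (0 : S) (ε / 2), ∀ k, x ≠ σ s * ι k) → φ x = 0 := by
    intro x hx
    simp only [φ]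
    split_ifs with h
    · obtain ⟨-, k, h2⟩ := h.choose_spec
      exact hf0 _ fun h3 => hx _ h3 k h2
    · rfl
  have hinv : ∀ h x, φ (x * ι h) = φ x := by
    intro h x
    by_cases hx : ∃ s ∈ Metric.ball (0 : S) ε, ∃ k, x = σ s * ι k
    · obtain ⟨s, hs, k, rfl⟩ := hx
      rw [mul_assoc, ← map_mul, hφ s hs, hφ s hs]
    · have hsub : ∀ s ∈ Metric.closedBall (0 : S) (ε / 2), s ∈ Metric.ball (0 : S) ε := fun s hs =>
        Metric.closedBall_subset_ball (by linarith) hs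
      rw [hφ0 x fun s hs k hk => hx ⟨s, hsub s hs, k, hk⟩, hφ0]
      intro s hs k hk
      exact hx ⟨s, hsub s hs, k * h⁻¹, by rw [map_mul, ← mul_assoc, ← hk]; simp⟩
  have hsm : ∀ s ∈ Metric.ball (0 : S) ε, ContMDiffAt 𝓘(ℝ, E) 𝓘(ℝ, ℝ) ∞ φ (σ s) := by
    intro s hs
    obtain ⟨p, hp1, hp2, hp3⟩ := hσp s hs
    have h1 : ContMDiffAt 𝓘(ℝ, E) 𝓘(ℝ, ℝ) ∞ (fun y => f (p y)) (σ s) :=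
      ContMDiffAt.comp (σ s) hf.contMDiff.contMDiffAt hp1
    refine h1.congr_of_eventuallyEq ?_
    filter_upwards [hp3, hp1.continuousAt.preimage_mem_nhds
      (Metric.isOpen_ball.mem_nhds (by rwa [hp2]))] with y ⟨k, hk⟩ hy
    conv_lhs => rw [hk]
    exact hφ _ hy k
  have hsmooth : ContMDiff 𝓘(ℝ, E) 𝓘(ℝ, ℝ) ∞ φ := by
    intro x
    by_cases hx : ∃ s ∈ Metric.closedBall (0 : S) (ε / 2), ∃ k, x = σ s * ι k
    · obtain ⟨s, hs, k, rfl⟩ := hx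
      have h1 : φ = fun y => φ (y * ι k⁻¹) := by funext y; rw [hinv]
      rw [h1]
      refine ContMDiffAt.comp (g := φ) (σ s * ι k) ?_ contMDiff_mul_right.contMDiffAt
      rw [map_inv, mul_inv_cancel_right]
      exact hsm s (Metric.closedBall_subset_ball (by linarith) hs)
    · have hclosed : IsClosed (σ '' Metric.closedBall (0 : S) (ε / 2) * Set.range ι) := by
        -- the product of a compact set and a closed subgroup is closed
        refine hemb.isClosed_range.mul_left_of_isCompact ?_
        exact (isCompact_closedBall _ _).image_of_continuousOn
          (hσc.mono (Metric.closedBall_subset_ball (by linarith)))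
      have hx' : x ∈ (σ '' Metric.closedBall (0 : S) (ε / 2) * Set.range ι)ᶜ := by
        rintro ⟨_, ⟨s, hs, rfl⟩, _, ⟨k, rfl⟩, h⟩
        exact hx ⟨s, hs, k, h.symm⟩
      refine (contMDiffAt_const (c := (0 : ℝ))).congr_of_eventuallyEq ?_
      filter_upwards [hclosed.isOpen_compl.mem_nhds hx'] with y hy
      refine hφ0 y fun s hs k hk => hy ?_
      exact ⟨_, ⟨s, hs, rfl⟩, _, ⟨k, rfl⟩, hk.symm⟩
  refine ⟨φ, hsmooth, hinv, ?_⟩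
  have hd : HasModelDerivAt φ 1 (modelDeriv φ 1 : E →L[ℝ] ℝ) :=
    hasModelDerivAt_modelDeriv (hsmooth.mdifferentiable (by simp) 1)
  suffices h : (modelDeriv φ 1 : E →L[ℝ] ℝ) = α by rwa [h] at hd
  have h1 : (modelDeriv φ 1 : E →L[ℝ] ℝ) ∘L S.subtypeL = α ∘L S.subtypeL := by
    have h2 : HasModelDerivAt (fun s : S => α (s : E)) 0 (α ∘L S.subtypeL) :=
      hasModelDerivAt_iff_hasFDerivAt.2 (α ∘L S.subtypeL).hasFDerivAt
    refine (hd.comp hσd hσ0).unique (h2.congr_of_eventuallyEq ?_)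
    filter_upwards [χ.eventuallyEq_one, Metric.ball_mem_nhds (0 : S) hε] with s hs1 hs2
    have := hφ s hs2 1
    rw [map_one, mul_one] at this
    rw [this]
    simp [f, hs1]
  have h2 : (modelDeriv φ 1 : E →L[ℝ] ℝ) ∘L (modelDeriv ι 1 : V →L[ℝ] E) = 0 := by
    have h3 : HasModelDerivAt ι (1 : G) (modelDeriv ι 1 : V →L[ℝ] E) :=
      hasModelDerivAt_modelDeriv (hι.mdifferentiable (by simp) 1)
    refine (hd.comp h3 (map_one ι)).unique
      ((hasModelDerivAt_const (φ 1) (1 : G)).congr_of_eventuallyEq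
        (Filter.Eventually.of_forall fun k => ?_))
    simpa using hinv k 1
  ext x
  have hx : x ∈ LinearMap.range ((modelDeriv ι 1 : V →L[ℝ] E) : V →ₗ[ℝ] E) ⊔ S := by
    rw [hS.sup_eq_top]; trivial
  obtain ⟨_, ⟨v, rfl⟩, s, hs, rfl⟩ := Submodule.mem_sup.1 hx
  have e1 := congrArg (fun L : S →L[ℝ] ℝ => L ⟨s, hs⟩) h1
  have e2 := congrArg (fun L : V →L[ℝ] ℝ => L v) h2
  simp at e1 e2
  simp [e1, e2, hα]

end Slice

/-! ### Gradients, the bracket and dual pairs -/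

section Lagrangian

variable {𝔤 : Type*} [AddCommGroup 𝔤] [Module ℝ 𝔤]

theorem form_comm (a b : 𝔤 × Module.Dual ℝ 𝔤) : form 𝔤 a b = form 𝔤 b a := by
  simp only [form_apply]; ring

theorem form_rMatrix_left (a b : 𝔤 × Module.Dual ℝ 𝔤) :
    form 𝔤 (rMatrix 𝔤 a) b = -form 𝔤 a (rMatrix 𝔤 b) := by
  simp only [form_apply, rMatrix_apply, LinearMap.neg_apply]; ring

theorem rMatrix_rMatrix (a : 𝔤 × Module.Dual ℝ 𝔤) : rMatrix 𝔤 (rMatrix 𝔤 a) = a := by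
  simp

theorem form_eq_zero_of_eigen {σ : ℝ} (hσ : σ * σ = 1) {a b : 𝔤 × Module.Dual ℝ 𝔤}
    (ha : rMatrix 𝔤 a = σ • a) (hb : rMatrix 𝔤 b = σ • b) : form 𝔤 a b = 0 := by
  have h := form_rMatrix_left a b
  rw [ha, hb, map_smul, LinearMap.smul_apply, map_smul, smul_eq_mul] at h
  have h2 : σ * (σ * form 𝔤 a b) = 0 := by rw [show σ * form 𝔤 a b = 0 by linarith, mul_zero]
  rwa [← mul_assoc, hσ, one_mul] at h2

/-- The eigenspaces of `r` are their own orthogonals. -/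
theorem eigen_of_forall_form_eq_zero [FiniteDimensional ℝ 𝔤] {σ : ℝ} (hσ : σ * σ = 1)
    {a : 𝔤 × Module.Dual ℝ 𝔤} (h : ∀ b, rMatrix 𝔤 b = σ • b → form 𝔤 a b = 0) :
    rMatrix 𝔤 a = σ • a := by
  -- `r a - σ a` lies in the other eigenspace and is orthogonal to everything
  have key : ∀ c, form 𝔤 (rMatrix 𝔤 a - σ • a) c = 0 := by
    intro c
    have h1 := h (c + σ • rMatrix 𝔤 c) (by
      rw [map_add, map_smul, rMatrix_rMatrix, smul_add, smul_smul, hσ, one_smul, add_comm])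
    rw [map_add, map_smul, smul_eq_mul] at h1
    rw [map_sub, LinearMap.sub_apply, form_rMatrix_left, map_smul, LinearMap.smul_apply,
      smul_eq_mul]
    have h2 : σ * (form 𝔤 a c + σ * form 𝔤 a (rMatrix 𝔤 c)) = 0 := by rw [h1, mul_zero]
    rw [mul_add, ← mul_assoc, hσ, one_mul] at h2
    linarith
  exact sub_eq_zero.1 ((form_nondegenerate 𝔤).1 _ key)

theorem eq_of_form_eq [FiniteDimensional ℝ 𝔤] {a b : 𝔤 × Module.Dual ℝ 𝔤}
    (h : ∀ c, form 𝔤 a c = form 𝔤 b c) : a = b :=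
  sub_eq_zero.1 ((form_nondegenerate 𝔤).1 _ fun c => by
    rw [map_sub, LinearMap.sub_apply, h, sub_self])

theorem eigen_one_iff (a : 𝔤 × Module.Dual ℝ 𝔤) :
    rMatrix 𝔤 a = (1 : ℝ) • a ↔ a ∈ LinearMap.range (LinearMap.inl ℝ 𝔤 (Module.Dual ℝ 𝔤)) := by
  rw [rMatrix_apply, one_smul, LinearMap.mem_range]
  constructor
  · intro h
    have h3 : a.2 = -a.2 := (congrArg Prod.snd h).symm
    exact ⟨a.1, Prod.ext rfl (by
      rw [eq_neg_iff_add_eq_zero, ← two_smul ℝ] at h3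
      exact ((smul_eq_zero.1 h3).resolve_left two_ne_zero).symm)⟩
  · rintro ⟨X, rfl⟩
    simp

theorem eigen_neg_one_iff (a : 𝔤 × Module.Dual ℝ 𝔤) :
    rMatrix 𝔤 a = (-1 : ℝ) • a ↔
      a ∈ LinearMap.range (LinearMap.inr ℝ 𝔤 (Module.Dual ℝ 𝔤)) := by
  have ha : (-1 : ℝ) • a = -a :=
    Prod.ext (neg_one_smul ℝ a.1) (LinearMap.ext fun Y => neg_one_mul (a.2 Y))
  rw [rMatrix_apply, ha, LinearMap.mem_range]
  constructor
  · intro h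
    have h3 : a.1 = -a.1 := congrArg Prod.fst h
    exact ⟨a.2, Prod.ext (by
      rw [eq_neg_iff_add_eq_zero, ← two_smul ℝ] at h3
      exact ((smul_eq_zero.1 h3).resolve_left two_ne_zero).symm) rfl⟩
  · rintro ⟨X, rfl⟩
    ext <;> simp

end Lagrangian

section Gradient

variable {E : Type*} [NormedAddCommGroup E] [NormedSpace ℝ E]
  {D : Type*} [TopologicalSpace D] [ChartedSpace E D] [Group D]
  {𝔤 : Type*} [LieRing 𝔤] [LieAlgebra ℝ 𝔤]
  (e : (𝔤 × Module.Dual ℝ 𝔤) ≃ₗ[ℝ] GroupLieAlgebra 𝓘(ℝ, E) D)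

/-- The identification of `𝔤 ⊕ 𝔤*` with the Lie algebra of `D`, regarded as the model space. -/
def modelEquiv : (𝔤 × Module.Dual ℝ 𝔤) ≃ₗ[ℝ] E := e

theorem form_leftGradient [FiniteDimensional ℝ 𝔤] (φ : D → ℝ) (x : D)
    (a : 𝔤 × Module.Dual ℝ 𝔤) :
    form 𝔤 (leftGradient e φ x) a =
      (modelDeriv (fun g => φ (g * x)) (1 : D) : E →L[ℝ] ℝ) (modelEquiv e a) :=
  form_represent _ a

theorem form_rightGradient [FiniteDimensional ℝ 𝔤] (φ : D → ℝ) (x : D)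
    (a : 𝔤 × Module.Dual ℝ 𝔤) :
    form 𝔤 (rightGradient e φ x) a =
      (modelDeriv (fun g => φ (x * g)) (1 : D) : E →L[ℝ] ℝ) (modelEquiv e a) :=
  form_represent _ a

/-- The adjoint representation on `𝔤 ⊕ 𝔤*`. -/
def doubleAd (x : D) : (𝔤 × Module.Dual ℝ 𝔤) →ₗ[ℝ] (𝔤 × Module.Dual ℝ 𝔤) :=
  (modelEquiv e).symm.toLinearMap ∘ₗ ((Ad x : E →L[ℝ] E) : E →ₗ[ℝ] E) ∘ₗ
    (modelEquiv e).toLinearMap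

theorem modelEquiv_doubleAd (x : D) (a : 𝔤 × Module.Dual ℝ 𝔤) :
    modelEquiv e (doubleAd e x a) = (Ad x : E →L[ℝ] E) (modelEquiv e a) := by
  simp [doubleAd]

variable [LieGroup 𝓘(ℝ, E) ∞ D]

theorem hasModelDerivAt_smooth_left (φ : C^∞⟮𝓘(ℝ, E), D; ℝ⟯) (x : D) :
    HasModelDerivAt (fun g => φ (g * x)) (1 : D)
      (modelDeriv (fun g => φ (g * x)) 1 : E →L[ℝ] ℝ) :=
  hasModelDerivAt_modelDeriv ((φ.contMDiff.comp contMDiff_mul_right).mdifferentiable (by simp) 1)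

theorem hasModelDerivAt_smooth_right (φ : C^∞⟮𝓘(ℝ, E), D; ℝ⟯) (x : D) :
    HasModelDerivAt (fun g => φ (x * g)) (1 : D)
      (modelDeriv (fun g => φ (x * g)) 1 : E →L[ℝ] ℝ) :=
  hasModelDerivAt_modelDeriv ((φ.contMDiff.comp contMDiff_mul_left).mdifferentiable (by simp) 1)

theorem doubleAd_surjective (x : D) : Function.Surjective (doubleAd e x) := by
  intro b
  refine ⟨doubleAd e x⁻¹ b, (modelEquiv e).injective ?_⟩
  rw [modelEquiv_doubleAd, modelEquiv_doubleAd, Ad_apply_Ad_inv]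

/-- The canonical form is invariant under the adjoint representation of a connected double. -/
theorem form_doubleAd [FiniteDimensional ℝ E] [ConnectedSpace D] {β : LieBialgebra 𝔤}
    (he : IsDouble β e) (x : D) (a b : 𝔤 × Module.Dual ℝ 𝔤) :
    form 𝔤 (doubleAd e x a) (doubleAd e x b) = form 𝔤 a b := by
  let B : E →L[ℝ] E →L[ℝ] ℝ := LinearMap.toContinuousBilinearMap
    ((form 𝔤).compl₁₂ (modelEquiv e).symm.toLinearMap (modelEquiv e).symm.toLinearMap)
  have hB : ∀ v w, B v w = form 𝔤 ((modelEquiv e).symm v) ((modelEquiv e).symm w) :=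
    fun v w => rfl
  have h := Ad_invariant (D := D) B (fun ξ η ζ => by
    have h1 := he.invariant ((modelEquiv e).symm ξ) ((modelEquiv e).symm η)
      ((modelEquiv e).symm ζ)
    have h2 : ∀ η : E, (modelEquiv e).symm (adMap E D ξ η) =
        e.symm ⁅e ((modelEquiv e).symm ξ), e ((modelEquiv e).symm η)⁆ := by
      intro η
      rw [← adMap_apply]
      change _ = (modelEquiv e).symm (adMap E D (modelEquiv e ((modelEquiv e).symm ξ))
        (modelEquiv e ((modelEquiv e).symm η)))
      simp
    rw [hB, hB, h2, h2]
    exact h1) x (modelEquiv e a) (modelEquiv e b)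
  rw [hB, hB] at h
  simpa [doubleAd] using h

variable [FiniteDimensional ℝ 𝔤]

/-- `X'_φ(x)` is the image of `X_φ(x)` under the transpose of `Ad x`. -/
theorem form_rightGradient_eq (φ : C^∞⟮𝓘(ℝ, E), D; ℝ⟯) (x : D) (a : 𝔤 × Module.Dual ℝ 𝔤) :
    form 𝔤 (rightGradient e φ x) a = form 𝔤 (leftGradient e φ x) (doubleAd e x a) := by
  rw [form_rightGradient, form_leftGradient, modelEquiv_doubleAd]
  have h := (hasModelDerivAt_smooth_left φ x).comp (hasModelDerivAt_conj (E := E) x) (by simp)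
  have h2 := (hasModelDerivAt_smooth_right φ x).unique (by simpa using h)
  exact congrArg (fun L : E →L[ℝ] ℝ => L (modelEquiv e a)) h2

theorem leftGradient_eq [FiniteDimensional ℝ E] [ConnectedSpace D] {β : LieBialgebra 𝔤}
    (he : IsDouble β e) (φ : C^∞⟮𝓘(ℝ, E), D; ℝ⟯) (x : D) :
    leftGradient e φ x = doubleAd e x (rightGradient e φ x) := by
  refine eq_of_form_eq fun c => ?_
  obtain ⟨b, rfl⟩ := doubleAd_surjective e x c
  rw [form_doubleAd e he, form_rightGradient_eq]

theorem form_leftGradient_leftGradient [FiniteDimensional ℝ E] [ConnectedSpace D]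
    {β : LieBialgebra 𝔤} (he : IsDouble β e) (φ ψ : C^∞⟮𝓘(ℝ, E), D; ℝ⟯) (x : D) :
    form 𝔤 (leftGradient e φ x) (leftGradient e ψ x) =
      form 𝔤 (rightGradient e φ x) (rightGradient e ψ x) := by
  rw [leftGradient_eq e he, leftGradient_eq e he, form_doubleAd e he]

/-- The derivative of the inversion at the identity. -/
theorem hasModelDerivAt_inv :
    HasModelDerivAt (fun g : D => g⁻¹) 1 (-ContinuousLinearMap.id ℝ E) := by
  set c := extChartAt 𝓘(ℝ, E) (1 : D) with hc
  have h0 : ContMDiffAt 𝓘(ℝ, E) 𝓘(ℝ, E) ∞ (fun g : D => g⁻¹) 1 := (contMDiff_inv _ _).contMDiffAt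
  have hI := hasModelDerivAt_modelDeriv (h0.mdifferentiableAt (by simp))
  set I : E →L[ℝ] E := modelDeriv (fun g : D => g⁻¹) 1
  have h1 := hasModelDerivAt_iff_hasFDerivAt.1 ((hasModelDerivAt_extChartAt_self (1 : D)).comp
    (hI.comp (hasModelDerivAt_extChartAt_symm_self (1 : D)) (by simp)) (by simp))
  rw [ContinuousLinearMap.comp_id, ContinuousLinearMap.id_comp] at h1
  have h2 : HasFDerivAt (chartMul E D) (fderiv ℝ (chartMul E D) (c 1, c 1))
      (c 1, c ((c.symm (c 1))⁻¹)) := by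
    have h3 : c ((c.symm (c 1))⁻¹) = c 1 := by rw [extChartAt_to_inv, inv_one]
    rw [h3]
    exact ((contDiffAt_chartMul (E := E) (D := D)).differentiableAt (by simp)).hasFDerivAt
  have h3 := HasFDerivAt.comp (f := fun u : E => (u, c ((c.symm u)⁻¹))) (c 1) h2
    ((hasFDerivAt_id (c 1)).prodMk h1)
  have hsrc : ∀ᶠ u in nhds (c 1), (c.symm u)⁻¹ ∈ c.source := by
    have h4 : ContinuousAt (fun u : E => (c.symm u)⁻¹) (c 1) :=
      (hI.comp (hasModelDerivAt_extChartAt_symm_self (1 : D))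
        (by simp)).mdifferentiableAt.continuousAt
    refine h4.preimage_mem_nhds ?_
    rw [extChartAt_to_inv, inv_one]
    exact extChartAt_source_mem_nhds 1
  have h4 := h3.unique ((hasFDerivAt_const (c (1 : D)) (c (1 : D))).congr_of_eventuallyEq (by
    filter_upwards [hsrc] with u hu
    change c (c.symm u * c.symm (c ((c.symm u)⁻¹))) = c 1
    rw [c.left_inv hu, mul_inv_cancel]))
  have h5 : I = -ContinuousLinearMap.id ℝ E := by
    ext w
    have h6 := congrArg (fun L : E →L[ℝ] E => L w) h4
    have h7 : fderiv ℝ (chartMul E D) (c 1, c 1) (w, I w) = w + I w := by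
      have : ((w, I w) : E × E) = (w, 0) + (0, I w) := by simp
      rw [this, map_add, fderiv_chartMul_inl, fderiv_chartMul_inr]
    have h8 : w + I w = 0 := h7 ▸ h6
    exact (neg_eq_of_add_eq_zero_right h8).symm
  rwa [h5] at hI

/-- The smooth function `x ↦ φ(x⁻¹)`. -/
def compInv (φ : C^∞⟮𝓘(ℝ, E), D; ℝ⟯) : C^∞⟮𝓘(ℝ, E), D; ℝ⟯ :=
  ⟨fun x => φ x⁻¹, φ.contMDiff.comp (contMDiff_inv _ _)⟩

@[simp] theorem compInv_apply (φ : C^∞⟮𝓘(ℝ, E), D; ℝ⟯) (x : D) : compInv φ x = φ x⁻¹ := rfl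

@[simp] theorem compInv_compInv (φ : C^∞⟮𝓘(ℝ, E), D; ℝ⟯) : compInv (compInv φ) = φ := by
  ext x; simp

theorem leftGradient_compInv (φ : C^∞⟮𝓘(ℝ, E), D; ℝ⟯) (x : D) :
    leftGradient e (compInv φ) x = -rightGradient e φ x⁻¹ := by
  refine eq_of_form_eq fun a => ?_
  rw [map_neg, LinearMap.neg_apply, form_leftGradient, form_rightGradient]
  have h := (hasModelDerivAt_smooth_right φ x⁻¹).comp (hasModelDerivAt_inv (E := E) (D := D))
    inv_one
  have h2 := (hasModelDerivAt_smooth_left (compInv φ) x).unique (by simpa using h)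
  rw [h2]
  simp

theorem rightGradient_compInv (φ : C^∞⟮𝓘(ℝ, E), D; ℝ⟯) (x : D) :
    rightGradient e (compInv φ) x = -leftGradient e φ x⁻¹ := by
  have h := leftGradient_compInv e (compInv φ) x⁻¹
  rw [compInv_compInv, inv_inv] at h
  rw [h, neg_neg]

/-- The inversion of `D` preserves the bracket. -/
theorem plusBracket_compInv (φ ψ : C^∞⟮𝓘(ℝ, E), D; ℝ⟯) :
    plusBracket e (compInv φ) (compInv ψ) = compInv (plusBracket e φ ψ) := by
  ext x
  change bracketFun e (compInv φ) (compInv ψ) x = bracketFun e φ ψ x⁻¹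
  simp only [bracketFun, leftGradient_compInv, rightGradient_compInv, map_neg,
    LinearMap.neg_apply, neg_neg]
  ring

end Gradient

section Action

variable {E : Type*} [NormedAddCommGroup E] [NormedSpace ℝ E]
  {D : Type*} [TopologicalSpace D] [ChartedSpace E D] [Group D] {G : Type*} [Group G]

theorem hasModelDerivAt_subgroup {V : Type*} [NormedAddCommGroup V] [NormedSpace ℝ V]
    [TopologicalSpace G] [ChartedSpace V G] {ι : G →* D}
    (hι : ContMDiff 𝓘(ℝ, V) 𝓘(ℝ, E) ∞ ι) :
    HasModelDerivAt ι (1 : G) (modelDeriv ι 1 : V →L[ℝ] E) :=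
  hasModelDerivAt_modelDeriv (hι.mdifferentiable (by simp) 1)

variable [LieGroup 𝓘(ℝ, E) ∞ D]

theorem compInv_mem_left_iff (ι : G →* D) (φ : C^∞⟮𝓘(ℝ, E), D; ℝ⟯) :
    compInv φ ∈ invariants (E := E) (leftTranslation ι) ↔
      φ ∈ invariants (E := E) (rightTranslation ι) := by
  change (∀ h x, φ (ι h * x)⁻¹ = φ x⁻¹) ↔ ∀ h x, φ (x * ι h) = φ x
  constructor
  · intro H h x
    have := H h⁻¹ x⁻¹
    simpa using this
  · intro H h x
    have := H h⁻¹ x⁻¹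
    simpa using this

theorem compInv_mem_right_iff (ι : G →* D) (φ : C^∞⟮𝓘(ℝ, E), D; ℝ⟯) :
    compInv φ ∈ invariants (E := E) (rightTranslation ι) ↔
      φ ∈ invariants (E := E) (leftTranslation ι) := by
  rw [← compInv_mem_left_iff, compInv_compInv]

variable {𝔤 : Type*} [LieRing 𝔤] [LieAlgebra ℝ 𝔤] [FiniteDimensional ℝ 𝔤]
  (e : (𝔤 × Module.Dual ℝ 𝔤) ≃ₗ[ℝ] GroupLieAlgebra 𝓘(ℝ, E) D)
  {V : Type*} [NormedAddCommGroup V] [NormedSpace ℝ V]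
  [TopologicalSpace G] [ChartedSpace V G]

/-- The Lie algebra of the subgroup `ι` is the eigenspace of `r` for the eigenvalue `σ`. -/
def HasEigenLieAlgebra (V : Type*) [NormedAddCommGroup V] [NormedSpace ℝ V]
    [ChartedSpace V G] (ι : G →* D) (σ : ℝ) : Prop :=
  ∀ a : 𝔤 × Module.Dual ℝ 𝔤,
    (∃ v : V, (modelDeriv ι 1 : V →L[ℝ] E) v = modelEquiv e a) ↔ rMatrix 𝔤 a = σ • a

variable {e} {ι : G →* D} {σ : ℝ}

/-- The left gradient of a left-invariant function lies in the Lie algebra of the subgroup. -/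
theorem leftGradient_eigen (hι : ContMDiff 𝓘(ℝ, V) 𝓘(ℝ, E) ∞ ι) (hσ : σ * σ = 1)
    (hk : HasEigenLieAlgebra e V ι σ) {φ : C^∞⟮𝓘(ℝ, E), D; ℝ⟯}
    (hφ : φ ∈ invariants (E := E) (leftTranslation ι)) (x : D) :
    rMatrix 𝔤 (leftGradient e φ x) = σ • leftGradient e φ x := by
  refine eigen_of_forall_form_eq_zero hσ fun b hb => ?_
  obtain ⟨v, hv⟩ := (hk b).2 hb
  rw [form_leftGradient, ← hv]
  have h := ((hasModelDerivAt_smooth_left φ x).comp (hasModelDerivAt_subgroup hι)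
    (map_one ι)).unique ((hasModelDerivAt_const (φ x) (1 : G)).congr_of_eventuallyEq
      (Filter.Eventually.of_forall fun h => hφ h x))
  exact congrArg (fun L : V →L[ℝ] ℝ => L v) h

theorem rightGradient_eigen (hι : ContMDiff 𝓘(ℝ, V) 𝓘(ℝ, E) ∞ ι) (hσ : σ * σ = 1)
    (hk : HasEigenLieAlgebra e V ι σ) {φ : C^∞⟮𝓘(ℝ, E), D; ℝ⟯}
    (hφ : φ ∈ invariants (E := E) (rightTranslation ι)) (x : D) :
    rMatrix 𝔤 (rightGradient e φ x) = σ • rightGradient e φ x := by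
  have h := leftGradient_eigen hι hσ hk ((compInv_mem_left_iff ι φ).2 hφ) x⁻¹
  rw [leftGradient_compInv, inv_inv, map_neg, smul_neg, neg_inj] at h
  exact h

/-- The left gradients of two left-invariant functions are orthogonal, and their right gradients
are left-invariant. -/
theorem isAdmissible_leftTranslation (hι : ContMDiff 𝓘(ℝ, V) 𝓘(ℝ, E) ∞ ι) (hσ : σ * σ = 1)
    (hk : HasEigenLieAlgebra e V ι σ) : IsAdmissible (plusBracket e) (leftTranslation ι) := by
  intro φ hφ ψ hψ h x
  have h1 : ∀ y, form 𝔤 (rMatrix 𝔤 (leftGradient e φ y)) (leftGradient e ψ y) = 0 := by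
    intro y
    have ha := leftGradient_eigen hι hσ hk hφ y
    rw [ha, map_smul, LinearMap.smul_apply,
      form_eq_zero_of_eigen hσ ha (leftGradient_eigen hι hσ hk hψ y), smul_zero]
  have h2 : ∀ χ ∈ invariants (E := E) (leftTranslation ι),
      rightGradient e χ (ι h * x) = rightGradient e χ x := by
    intro χ hχ
    have : (fun g => χ (ι h * x * g)) = fun g => χ (x * g) := by
      funext g
      rw [mul_assoc]
      exact hχ h (x * g)
    refine eq_of_form_eq fun c => ?_
    rw [form_rightGradient, form_rightGradient, this]
  change bracketFun e φ ψ (ι h * x) = bracketFun e φ ψ x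
  simp only [bracketFun, h1, h2 φ hφ, h2 ψ hψ]

theorem isAdmissible_rightTranslation (hι : ContMDiff 𝓘(ℝ, V) 𝓘(ℝ, E) ∞ ι) (hσ : σ * σ = 1)
    (hk : HasEigenLieAlgebra e V ι σ) : IsAdmissible (plusBracket e) (rightTranslation ι) := by
  intro φ hφ ψ hψ
  rw [← compInv_mem_left_iff] at hφ hψ ⊢
  rw [← plusBracket_compInv]
  exact isAdmissible_leftTranslation hι hσ hk _ hφ _ hψ

/-- For a closed subgroup, the right gradients of the right-invariant functions fill out the Lie
algebra of the subgroup. -/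
theorem exists_right_invariant [FiniteDimensional ℝ E] [FiniteDimensional ℝ V]
    [LieGroup 𝓘(ℝ, V) ∞ G] (hι : ContMDiff 𝓘(ℝ, V) 𝓘(ℝ, E) ∞ ι) (hσ : σ * σ = 1)
    (hk : HasEigenLieAlgebra e V ι σ)
    (hinj : Function.Injective (modelDeriv ι 1 : V →L[ℝ] E))
    (hcl : Topology.IsClosedEmbedding ι) (x : D) {a : 𝔤 × Module.Dual ℝ 𝔤}
    (ha : rMatrix 𝔤 a = σ • a) :
    ∃ φ ∈ invariants (E := E) (rightTranslation ι), rightGradient e φ x = a := by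
  let α : E →L[ℝ] ℝ :=
    LinearMap.toContinuousLinearMap ((form 𝔤 a) ∘ₗ (modelEquiv e).symm.toLinearMap)
  have hα : ∀ b, α (modelEquiv e b) = form 𝔤 a b := by intro b; simp [α]
  obtain ⟨φ, hφ, hφi, hφd⟩ := exists_invariant_function hι hcl hinj α (fun v => by
    have h1 := hα ((modelEquiv e).symm ((modelDeriv ι 1 : V →L[ℝ] E) v))
    rw [LinearEquiv.apply_symm_apply] at h1
    rw [h1]
    exact form_eq_zero_of_eigen hσ ha ((hk _).1 ⟨v, by simp⟩))
  refine ⟨⟨fun y => φ (x⁻¹ * y), hφ.comp contMDiff_mul_left⟩, fun h y => ?_, ?_⟩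
  · change φ (x⁻¹ * (y * ι h)) = φ (x⁻¹ * y)
    rw [← mul_assoc, hφi]
  · refine eq_of_form_eq fun b => ?_
    rw [form_rightGradient, ← hα]
    have : (fun g => φ (x⁻¹ * (x * g))) = φ := by funext g; simp
    change (modelDeriv (fun g => φ (x⁻¹ * (x * g))) (1 : D) : E →L[ℝ] ℝ) _ = _
    rw [this, hφd.modelDeriv_eq]

/-- A function whose left gradient is orthogonal to the Lie algebra of a connected subgroup is
left-invariant. -/
theorem mem_invariants_of_leftDifferential_eq_zero [LieGroup 𝓘(ℝ, V) ∞ G] [ConnectedSpace G]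
    (hι : ContMDiff 𝓘(ℝ, V) 𝓘(ℝ, E) ∞ ι)
    {ψ : C^∞⟮𝓘(ℝ, E), D; ℝ⟯}
    (h : ∀ x v, (modelDeriv (fun g => ψ (g * x)) (1 : D) : E →L[ℝ] ℝ)
      ((modelDeriv ι 1 : V →L[ℝ] E) v) = 0) :
    ψ ∈ invariants (E := E) (leftTranslation ι) := by
  intro k x
  have key := eq_of_modelDeriv_translate_eq_zero (E := V) (f := fun k : G => ψ (ι k * x))
    (fun k' => by
      have h1 := (hasModelDerivAt_smooth_left ψ (ι k' * x)).comp (hasModelDerivAt_subgroup hι)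
        (map_one ι)
      have h2 : (modelDeriv (fun g => ψ (g * (ι k' * x))) (1 : D) : E →L[ℝ] ℝ) ∘L
          (modelDeriv ι 1 : V →L[ℝ] E) = 0 := by
        ext v
        exact h _ v
      rw [h2] at h1
      simpa [mul_assoc] using h1) k 1
  change ψ (ι k * x) = ψ x
  simpa using key

variable [FiniteDimensional ℝ E] [ConnectedSpace D] {β : LieBialgebra 𝔤}

/-- If `φ` is right-invariant, the right term of `{φ, ψ}₊` becomes `σ ⟨X'_φ, X'_ψ⟩`, which is
`σ ⟨X_φ, X_ψ⟩` by the invariance of the form. -/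
theorem bracketFun_of_right_invariant (he : IsDouble β e)
    (hι : ContMDiff 𝓘(ℝ, V) 𝓘(ℝ, E) ∞ ι) (hσ : σ * σ = 1)
    (hk : HasEigenLieAlgebra e V ι σ) {φ : C^∞⟮𝓘(ℝ, E), D; ℝ⟯}
    (hφ : φ ∈ invariants (E := E) (rightTranslation ι)) (ψ : C^∞⟮𝓘(ℝ, E), D; ℝ⟯) (x : D) :
    bracketFun e φ ψ x = 1 / 2 *
      form 𝔤 (rMatrix 𝔤 (leftGradient e φ x) + σ • leftGradient e φ x) (leftGradient e ψ x) := by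
  rw [bracketFun, rightGradient_eigen hι hσ hk hφ, map_smul (form 𝔤), LinearMap.smul_apply,
    ← form_leftGradient_leftGradient e he, map_add, LinearMap.add_apply, map_smul,
    LinearMap.smul_apply]
  ring

/-- Left-invariant functions commute with right-invariant functions. -/
theorem left_subset_centralizer_right (he : IsDouble β e)
    (hι : ContMDiff 𝓘(ℝ, V) 𝓘(ℝ, E) ∞ ι) (hσ : σ * σ = 1)
    (hk : HasEigenLieAlgebra e V ι σ) {ψ : C^∞⟮𝓘(ℝ, E), D; ℝ⟯}
    (hψ : ψ ∈ invariants (E := E) (leftTranslation ι)) :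
    ψ ∈ poissonCentralizer (plusBracket e) (invariants (E := E) (rightTranslation ι)) := by
  intro φ hφ
  ext x
  change bracketFun e φ ψ x = 0
  rw [bracketFun_of_right_invariant he hι hσ hk hφ, map_add, LinearMap.add_apply,
    form_rMatrix_left, leftGradient_eigen hι hσ hk hψ]
  simp

variable [FiniteDimensional ℝ V] [LieGroup 𝓘(ℝ, V) ∞ G] [ConnectedSpace G]

/-- A function commuting with the right-invariant functions of a closed subgroup is
left-invariant. -/
theorem centralizer_right_subset_left (he : IsDouble β e)
    (hι : ContMDiff 𝓘(ℝ, V) 𝓘(ℝ, E) ∞ ι) (hσ : σ * σ = 1)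
    (hk : HasEigenLieAlgebra e V ι σ)
    (hinj : Function.Injective (modelDeriv ι 1 : V →L[ℝ] E))
    (hcl : Topology.IsClosedEmbedding ι) {ψ : C^∞⟮𝓘(ℝ, E), D; ℝ⟯}
    (hψ : ψ ∈ poissonCentralizer (plusBracket e) (invariants (E := E) (rightTranslation ι))) :
    ψ ∈ invariants (E := E) (leftTranslation ι) := by
  refine mem_invariants_of_leftDifferential_eq_zero hι fun x v => ?_
  -- the projection onto the Lie algebra of the subgroup
  let p : (𝔤 × Module.Dual ℝ 𝔤) →ₗ[ℝ] (𝔤 × Module.Dual ℝ 𝔤) :=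
    (1 / 2 : ℝ) • (LinearMap.id + σ • rMatrix 𝔤)
  have hp : ∀ a, p a = (1 / 2 : ℝ) • (a + σ • rMatrix 𝔤 a) := fun a => rfl
  have hpe : ∀ a, rMatrix 𝔤 (p a) = σ • p a := by
    intro a
    rw [hp, map_smul, map_add, map_smul, rMatrix_rMatrix, smul_comm σ, smul_add σ, smul_smul σ,
      hσ, one_smul, add_comm]
  have hpid : ∀ a, rMatrix 𝔤 a = σ • a → p a = a := by
    intro a ha
    rw [hp, ha, smul_smul, hσ, one_smul, ← two_smul ℝ a, smul_smul]
    norm_num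
  let P : E →L[ℝ] E := LinearMap.toContinuousLinearMap
    ((modelEquiv e).toLinearMap ∘ₗ p ∘ₗ (modelEquiv e).symm.toLinearMap)
  have hP : ∀ a, P (modelEquiv e a) = modelEquiv e (p a) := by intro a; simp [P]
  have hPP : ∀ w, P (P w) = P w := by
    intro w
    obtain ⟨a, rfl⟩ := (modelEquiv e).surjective w
    rw [hP, hP, hpid _ (hpe a)]
  have hclosed : IsClosed {y : D | (modelDeriv (fun g => ψ (g * y)) (1 : D) : E →L[ℝ] ℝ)
      ((modelDeriv ι 1 : V →L[ℝ] E) v) = 0} :=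
    isClosed_eq (contMDiff_leftDifferential ψ ((modelDeriv ι 1 : V →L[ℝ] E) v)).continuous
      continuous_const
  -- by continuity, only the dense set of points where `p ∘ Ad` is onto has to be considered
  refine hclosed.closure_subset_iff.2 (fun y hy => ?_) (dense_proj_Ad_surjOn (D := D) P hPP x)
  obtain ⟨b, hb⟩ := (modelEquiv e).surjective ((modelDeriv ι 1 : V →L[ℝ] E) v)
  have hbk : rMatrix 𝔤 b = σ • b := (hk b).1 ⟨v, hb.symm⟩
  obtain ⟨w, hw⟩ := hy (modelEquiv e b)
  obtain ⟨a, rfl⟩ := (modelEquiv e).surjective w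
  rw [hP, ← modelEquiv_doubleAd, hP, hP, hpid b hbk] at hw
  have hw' : p (doubleAd e y (p a)) = b := (modelEquiv e).injective hw
  obtain ⟨φ, hφ, hφa⟩ := exists_right_invariant hι hσ hk hinj hcl y (hpe a)
  have h0 : bracketFun e φ ψ y = 0 := congrArg (fun χ : C^∞⟮𝓘(ℝ, E), D; ℝ⟯ => χ y) (hψ φ hφ)
  rw [bracketFun_of_right_invariant he hι hσ hk hφ, leftGradient_eq e he φ, hφa] at h0
  -- `r + σ` is twice `σ` times the projection onto the eigenspace
  have h1 : rMatrix 𝔤 (doubleAd e y (p a)) + σ • doubleAd e y (p a) = (2 * σ) • b := by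
    rw [← hw', hp (doubleAd e y (p a)), smul_smul, show 2 * σ * (1 / 2) = σ by ring, smul_add,
      smul_smul, hσ, one_smul, add_comm]
  rw [h1, map_smul, LinearMap.smul_apply, smul_eq_mul, form_comm, form_leftGradient, hb] at h0
  have hσ0 : σ ≠ 0 := by rintro rfl; simp at hσ
  have h2 : 1 / 2 * (2 * σ * (modelDeriv (fun g => ψ (g * y)) (1 : D) : E →L[ℝ] ℝ)
      ((modelDeriv ι 1 : V →L[ℝ] E) v)) = 0 := h0
  have h3 : σ * (modelDeriv (fun g => ψ (g * y)) (1 : D) : E →L[ℝ] ℝ)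
      ((modelDeriv ι 1 : V →L[ℝ] E) v) = 0 := by linarith
  exact (mul_eq_zero.1 h3).resolve_left hσ0

theorem isDualPair_translations (he : IsDouble β e)
    (hι : ContMDiff 𝓘(ℝ, V) 𝓘(ℝ, E) ∞ ι) (hσ : σ * σ = 1)
    (hk : HasEigenLieAlgebra e V ι σ)
    (hinj : Function.Injective (modelDeriv ι 1 : V →L[ℝ] E))
    (hcl : Topology.IsClosedEmbedding ι) :
    IsDualPair (plusBracket e) (leftTranslation ι) (rightTranslation ι) := by
  have hleft : (invariants (E := E) (leftTranslation ι) : Set C^∞⟮𝓘(ℝ, E), D; ℝ⟯) =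
      poissonCentralizer (plusBracket e) (invariants (E := E) (rightTranslation ι)) :=
    Set.Subset.antisymm (fun ψ hψ => left_subset_centralizer_right he hι hσ hk hψ)
      (fun ψ hψ => centralizer_right_subset_left he hι hσ hk hinj hcl hψ)
  refine ⟨isAdmissible_leftTranslation hι hσ hk, isAdmissible_rightTranslation hι hσ hk, hleft, ?_⟩
  -- the inversion of `D` exchanges the two actions and preserves the bracket
  ext ψ
  have h1 : ψ ∈ invariants (E := E) (rightTranslation ι) ↔
      compInv ψ ∈ poissonCentralizer (plusBracket e)
        (invariants (E := E) (rightTranslation ι)) := by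
    rw [← compInv_mem_left_iff, ← SetLike.mem_coe, hleft]
  refine h1.trans ⟨fun h φ hφ => ?_, fun h φ hφ => ?_⟩
  · have h2 := h (compInv φ) ((compInv_mem_right_iff ι φ).2 hφ)
    rw [plusBracket_compInv] at h2
    rw [← compInv_compInv (plusBracket e φ ψ), h2]
    rfl
  · have h2 := h (compInv φ) ((compInv_mem_left_iff ι φ).2 hφ)
    rw [← compInv_compInv φ, plusBracket_compInv, h2]
    rfl

end Action

section Subgroups

variable {E : Type*} [NormedAddCommGroup E] [NormedSpace ℝ E]
  {D : Type*} [TopologicalSpace D] [ChartedSpace E D] [Group D]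
  {𝔤 : Type*} [LieRing 𝔤] [LieAlgebra ℝ 𝔤]
  {e : (𝔤 × Module.Dual ℝ 𝔤) ≃ₗ[ℝ] GroupLieAlgebra 𝓘(ℝ, E) D}
  {V : Type*} [NormedAddCommGroup V] [NormedSpace ℝ V]
  {G : Type*} [TopologicalSpace G] [ChartedSpace V G] [Group G] {ι : G →* D}

theorem IsLieSubgroup.hasEigenLieAlgebra {𝔨 : Submodule ℝ (𝔤 × Module.Dual ℝ 𝔤)} {σ : ℝ}
    (hι : IsLieSubgroup (V := V) ι (𝔨.map e.toLinearMap))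
    (h𝔨 : ∀ a, rMatrix 𝔤 a = σ • a ↔ a ∈ 𝔨) : HasEigenLieAlgebra e V ι σ := by
  intro a
  rw [h𝔨]
  refine (hι.range_mfderiv (modelEquiv e a)).trans ?_
  constructor
  · rintro ⟨b, hb, hab⟩
    have : b = a := e.injective hab
    exact this ▸ hb
  · exact fun ha => ⟨a, ha, rfl⟩

end Subgroups

end PoissonDouble

end

open PoissonDouble in
theorem theorem2p1
    {𝔤 : Type*} [LieRing 𝔤] [LieAlgebra ℝ 𝔤] [FiniteDimensional ℝ 𝔤] (β : LieBialgebra 𝔤)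
    {E : Type*} [NormedAddCommGroup E] [NormedSpace ℝ E] [FiniteDimensional ℝ E]
    {D : Type*} [TopologicalSpace D] [ChartedSpace E D] [Group D] [LieGroup 𝓘(ℝ, E) ∞ D]
    [T2Space D] [ConnectedSpace D]
    (e : (𝔤 × Module.Dual ℝ 𝔤) ≃ₗ[ℝ] GroupLieAlgebra 𝓘(ℝ, E) D) (he : IsDouble β e)
    {V : Type*} [NormedAddCommGroup V] [NormedSpace ℝ V] [FiniteDimensional ℝ V]
    {G : Type*} [TopologicalSpace G] [ChartedSpace V G] [Group G] [LieGroup 𝓘(ℝ, V) ∞ G]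
    [T2Space G] [ConnectedSpace G]
    (ι : G →* D)
    (hι : IsLieSubgroup (V := V) ι
      ((LinearMap.range (LinearMap.inl ℝ 𝔤 (Module.Dual ℝ 𝔤))).map e.toLinearMap))
    {V' : Type*} [NormedAddCommGroup V'] [NormedSpace ℝ V'] [FiniteDimensional ℝ V']
    {G' : Type*} [TopologicalSpace G'] [ChartedSpace V' G'] [Group G'] [LieGroup 𝓘(ℝ, V') ∞ G']
    [T2Space G'] [ConnectedSpace G']
    (ι' : G' →* D)
    (hι' : IsLieSubgroup (V := V') ι'
      ((LinearMap.range (LinearMap.inr ℝ 𝔤 (Module.Dual ℝ 𝔤))).map e.toLinearMap)) :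
    (IsAdmissible (plusBracket e) (leftTranslation ι)
      ∧ IsAdmissible (plusBracket e) (rightTranslation ι)
      ∧ IsAdmissible (plusBracket e) (leftTranslation ι')
      ∧ IsAdmissible (plusBracket e) (rightTranslation ι'))
    ∧ (Topology.IsClosedEmbedding ι →
        IsDualPair (plusBracket e) (leftTranslation ι) (rightTranslation ι))
    ∧ (Topology.IsClosedEmbedding ι' →
        IsDualPair (plusBracket e) (leftTranslation ι') (rightTranslation ι')) := by
  have h := hι.hasEigenLieAlgebra eigen_one_iff
  have h' := hι'.hasEigenLieAlgebra eigen_neg_one_iff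
  have s : (1 : ℝ) * 1 = 1 := by norm_num
  have s' : (-1 : ℝ) * -1 = 1 := by norm_num
  exact ⟨⟨isAdmissible_leftTranslation hι.contMDiff s h,
      isAdmissible_rightTranslation hι.contMDiff s h,
      isAdmissible_leftTranslation hι'.contMDiff s' h',
      isAdmissible_rightTranslation hι'.contMDiff s' h'⟩,
    isDualPair_translations he hι.contMDiff s h hι.injective_mfderiv,
    isDualPair_translations he hι'.contMDiff s' h' hι'.injective_mfderiv⟩
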